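/- Write $z=x+iy$, $w=u+iv$ for the coordinates of $\mathbb C^2$. A set $M\subset\mathbb C^2$ is (near $p\in M$) a real analytic hypersurface of finite type $k$ at $p$ if there are local holomorphic coordinates $(z,w)$ centred at $p$ in which $M$ is given near $p$ by a real analytic equation $$v=\sum_{j=1}^{k-1}a_jz^j\bar z^{\,k-j}+o(|z|^k+|u|),\qquad (z,u)\to 0,$$ where $a_j\in\mathbb C$, $a_j=\overline{a_{k-j}}$, and not all $a_j$ are zero. **Proposition 5.1.** Let $F$ and $G$ be real-valued, real analytic functions near $0\in\mathbb R$ with $F(0)=F'(0)=0$ and $G(0)=G'(0)=0$ (so that the hyperplane $\{v=0\}$ is tangent at the origin to both hypersurfaces below). Let $k>2$, and suppose that the tube hypersurfaces $M_1: v=F(x)$ and $M_2: v=G(x)$ are of finite type $k$ at the origin. Let $\Psi$ be a local biholomorphism of $\mathbb C^2$ at the origin with $\Psi(0)=0$ which maps $M_1$ to $M_2$ (i.e. $\Psi(p)\in M_2$ for all $p\in M_1$ sufficiently close to $0$). Then there are $a,c\in\mathbb R\setminus\{0\}$ and $b\in\mathbb R$ such that, near the origin, $\Psi$ is the linear map $$z^*=az+ibw,\qquad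 w^*=cw,$$ and $F$ and $G$ satisfy $$G(ax-bF(x))=cF(x)$$ for all $x$ in a neighbourhood of $0$. -/

import Mathlib

open Filter Topology Asymptotics

/-- `Φ` is a local biholomorphism of `ℂ²` at `p`: near `p` it agrees with a homeomorphism between
open sets which is holomorphic together with its inverse. -/
def IsLocalBiholomorphismAt (Φ : ℂ × ℂ → ℂ × ℂ) (p : ℂ × ℂ) : Prop :=
  ∃ e : OpenPartialHomeomorph (ℂ × ℂ) (ℂ × ℂ),
    p ∈ e.source ∧ Φ =ᶠ[𝓝 p] e ∧
      AnalyticOnNhd ℂ e e.source ∧ AnalyticOnNhd ℂ e.symm e.target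

/-- The polynomial `∑_{j=1}^{k-1} a_j z^j z̄^{k-j}`, homogeneous of degree `k` and without
harmonic terms. -/
noncomputable def leadingTerm (k : ℕ) (a : ℕ → ℂ) (z : ℂ) : ℂ :=
  ∑ j ∈ Finset.Ico 1 k, a j * z ^ j * (starRingEnd ℂ z) ^ (k - j)

/-- `M ⊆ ℂ²` is near `p` a real analytic hypersurface, and `p` is a point of finite type `k`:
there are local holomorphic coordinates `(z, w)`, `w = u + i v`, centred at `p`, in which `M` is
given by a real analytic equation `v = H(z, u)` with
`H(z, u) = ∑_{j=1}^{k-1} a_j z^j z̄^{k-j} + o(|z|^k + |u|)`,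
where the leading term is nonzero and real valued (`a_j` is the conjugate of `a_{k-j}`). -/
def HasFiniteTypeAt (M : Set (ℂ × ℂ)) (p : ℂ × ℂ) (k : ℕ) : Prop :=
  ∃ (Φ : ℂ × ℂ → ℂ × ℂ) (H : ℂ × ℝ → ℝ) (a : ℕ → ℂ),
    IsLocalBiholomorphismAt Φ p ∧ Φ p = 0 ∧ AnalyticAt ℝ H 0 ∧
    (∀ᶠ q in 𝓝 p, q ∈ M ↔ (Φ q).2.im = H ((Φ q).1, (Φ q).2.re)) ∧
    (∀ j ∈ Finset.Ico 1 k, a j = starRingEnd ℂ (a (k - j))) ∧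
    (∃ j ∈ Finset.Ico 1 k, a j ≠ 0) ∧
    (fun q : ℂ × ℝ => (H q : ℂ) - leadingTerm k a q.1) =o[𝓝 0]
      (fun q : ℂ × ℝ => ‖q.1‖ ^ k + |q.2|)

/-- The tube `v = F(x)` in `ℂ²`, where `z = x + i y` and `w = u + i v`. Only its germ at the
origin matters. -/
def tube (F : ℝ → ℝ) : Set (ℂ × ℂ) :=
  {p | p.2.im = F p.1.re}

/-- The partial derivative in the first variable. -/
noncomputable def dz (h : ℂ × ℂ → ℂ) (p : ℂ × ℂ) : ℂ := fderiv ℂ h p (1, 0)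

/-- The partial derivative in the second variable. -/
noncomputable def dw (h : ℂ × ℂ → ℂ) (p : ℂ × ℂ) : ℂ := fderiv ℂ h p (0, 1)

lemma analyticAt_dz {h : ℂ × ℂ → ℂ} {p : ℂ × ℂ} (hh : AnalyticAt ℂ h p) :
    AnalyticAt ℂ (dz h) p :=
  ((ContinuousLinearMap.apply ℂ ℂ ((1, 0) : ℂ × ℂ)).analyticAt _).comp hh.fderiv

lemma analyticAt_dw {h : ℂ × ℂ → ℂ} {p : ℂ × ℂ} (hh : AnalyticAt ℂ h p) :
    AnalyticAt ℂ (dw h) p :=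
  ((ContinuousLinearMap.apply ℂ ℂ ((0, 1) : ℂ × ℂ)).analyticAt _).comp hh.fderiv

lemma fderiv_apply_eq_dz_dw (h : ℂ × ℂ → ℂ) (p : ℂ × ℂ) (a b : ℂ) :
    fderiv ℂ h p (a, b) = a * dz h p + b * dw h p := by
  have : ((a, b) : ℂ × ℂ) = a • (1, 0) + b • (0, 1) := by simp
  rw [this, map_add, map_smul, map_smul]; rfl

lemma hasDerivAt_comp_curve {h : ℂ × ℂ → ℂ} {z w : ℝ → ℂ} {z' w' : ℂ} {t : ℝ}
    (hh : AnalyticAt ℂ h (z t, w t)) (hz : HasDerivAt z z' t) (hw : HasDerivAt w w' t) :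
    HasDerivAt (fun s => h (z s, w s))
      (z' * dz h (z t, w t) + w' * dw h (z t, w t)) t := by
  rw [← fderiv_apply_eq_dz_dw]
  exact (hh.differentiableAt.hasFDerivAt.restrictScalars ℝ).comp_hasDerivAt t (hz.prodMk hw)

lemma hasDerivAt_re {h : ℝ → ℂ} {h' : ℂ} {t : ℝ} (hh : HasDerivAt h h' t) :
    HasDerivAt (fun s => (h s).re) h'.re t :=
  Complex.reCLM.hasFDerivAt.comp_hasDerivAt t hh

lemma hasDerivAt_im {h : ℝ → ℂ} {h' : ℂ} {t : ℝ} (hh : HasDerivAt h h' t) :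
    HasDerivAt (fun s => (h s).im) h'.im t :=
  Complex.imCLM.hasFDerivAt.comp_hasDerivAt t hh

/-- An analytic function of one variable that vanishes on a real line through the origin
vanishes near the origin. -/
lemma eventually_eq_zero_of_real_line {h : ℂ → ℂ} (hh : AnalyticAt ℂ h 0) {ω : ℂ} (hω : ω ≠ 0)
    (h0 : ∀ᶠ t : ℝ in 𝓝 0, h (t * ω) = 0) : h =ᶠ[𝓝 0] 0 := by
  refine (hh.frequently_zero_iff_eventually_zero).1 ?_
  have ht : Tendsto (fun t : ℝ => (t : ℂ) * ω) (𝓝[≠] 0) (𝓝[≠] 0) := by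
    refine tendsto_nhdsWithin_iff.2 ⟨?_, ?_⟩
    · have : Continuous fun t : ℝ => (t : ℂ) * ω := by fun_prop
      simpa using (this.tendsto 0).mono_left nhdsWithin_le_nhds
    · filter_upwards [self_mem_nhdsWithin] with t ht
      simpa [hω] using ht
  exact ht.frequently (h0.filter_mono nhdsWithin_le_nhds).frequently

/-- An analytic function vanishing on the totally real plane `iℝ × ℝ` vanishes. -/
lemma eventually_eq_zero_of_totally_real {h : ℂ × ℂ → ℂ} (hh : AnalyticAt ℂ h 0)
    (h0 : ∀ᶠ q : ℝ × ℝ in 𝓝 0, h (q.1 * Complex.I, q.2) = 0) : h =ᶠ[𝓝 0] 0 := by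
  obtain ⟨r, hr, hrh⟩ := Metric.eventually_nhds_iff_ball.1 hh.eventually_analyticAt
  obtain ⟨s, hs, hsh⟩ := Metric.eventually_nhds_iff_ball.1 h0
  have key : ∀ (φ : ℂ → ℂ) (ω : ℂ), ω ≠ 0 → AnalyticOnNhd ℂ φ (Metric.ball 0 r) →
      (∀ᶠ t : ℝ in 𝓝 0, φ (t * ω) = 0) → ∀ z ∈ Metric.ball (0 : ℂ) r, φ z = 0 := by
    intro φ ω hω hφ h1 z hz
    have := eventually_eq_zero_of_real_line (hφ 0 (Metric.mem_ball_self hr)) hω h1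
    exact hφ.eqOn_zero_of_preconnected_of_eventuallyEq_zero
      (convex_ball (0 : ℂ) r).isPreconnected (Metric.mem_ball_self hr) this hz
  have mem : ∀ z w : ℂ, z ∈ Metric.ball (0 : ℂ) r → w ∈ Metric.ball (0 : ℂ) r →
      AnalyticAt ℂ h (z, w) := by
    intro z w hz hw
    refine hrh _ ?_
    rw [show (0 : ℂ × ℂ) = (0, 0) from rfl, ← ball_prod_same]
    exact ⟨hz, hw⟩
  have e1 : ∀ᶠ t : ℝ in 𝓝 0, |t| < s ∧ |t| < r := by
    have := Metric.ball_mem_nhds (0 : ℝ) (lt_min hs hr)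
    filter_upwards [this] with t ht
    simpa [Real.norm_eq_abs] using ht
  have step : ∀ᶠ u : ℝ in 𝓝 0, ∀ z ∈ Metric.ball (0 : ℂ) r, h (z, u) = 0 := by
    filter_upwards [e1] with u hu
    refine key (fun z => h (z, u)) Complex.I Complex.I_ne_zero ?_ ?_
    · intro z hz
      refine (mem z u hz (by simpa using hu.2)).comp₂ analyticAt_id analyticAt_const
    · filter_upwards [e1] with t ht
      refine hsh (t, u) ?_
      rw [show (0 : ℝ × ℝ) = (0, 0) from rfl, ← ball_prod_same]
      exact ⟨by simpa using ht.1, by simpa using hu.1⟩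
  filter_upwards [Metric.ball_mem_nhds (0 : ℂ × ℂ) hr] with p hp
  rw [show (0 : ℂ × ℂ) = (0, 0) from rfl, ← ball_prod_same] at hp
  refine key (fun w => h (p.1, w)) 1 one_ne_zero ?_ ?_ p.2 hp.2
  · intro w hw
    exact (mem p.1 w hp.1 hw).comp₂ analyticAt_const analyticAt_id
  · filter_upwards [step] with u hu
    simpa using hu p.1 hp.1

lemma eventually_eq_of_dz_eq_zero {h : ℂ × ℂ → ℂ} (hh : AnalyticAt ℂ h 0)
    (h0 : dz h =ᶠ[𝓝 0] 0) : ∀ᶠ p in 𝓝 0, h p = h (0, p.2) := by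
  obtain ⟨r, hr, hrh⟩ := Metric.eventually_nhds_iff_ball.1 (hh.eventually_analyticAt.and h0)
  filter_upwards [Metric.ball_mem_nhds (0 : ℂ × ℂ) hr] with p hp
  rw [show (0 : ℂ × ℂ) = (0, 0) from rfl, ← ball_prod_same] at hp hrh
  have hd : ∀ z ∈ Metric.ball (0 : ℂ) r, HasDerivAt (fun z => h (z, p.2)) 0 z := by
    intro z hz
    obtain ⟨ha, hz0⟩ := hrh (z, p.2) ⟨hz, hp.2⟩
    have := ha.differentiableAt.hasFDerivAt.comp_hasDerivAt z
      ((hasDerivAt_id z).prodMk (hasDerivAt_const z p.2))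
    have e : fderiv ℂ h (z, p.2) (1, 0) = 0 := hz0
    rwa [e] at this
  exact (convex_ball (0 : ℂ) r).is_const_of_fderivWithin_eq_zero (𝕜 := ℂ)
    (fun z hz => (hd z hz).differentiableAt.differentiableWithinAt)
    (fun z hz => by
      rw [fderivWithin_of_isOpen Metric.isOpen_ball hz]
      ext; simpa using (hd z hz).deriv) hp.1 (Metric.mem_ball_self hr)

lemma eventually_eq_const_of_dz_dw_eq_zero {h : ℂ × ℂ → ℂ} (hh : AnalyticAt ℂ h 0)
    (h0 : dz h =ᶠ[𝓝 0] 0) (h1 : dw h =ᶠ[𝓝 0] 0) : ∀ᶠ p in 𝓝 0, h p = h 0 := by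
  obtain ⟨r, hr, hrh⟩ :=
    Metric.eventually_nhds_iff_ball.1 (hh.eventually_analyticAt.and (h0.and h1))
  filter_upwards [Metric.ball_mem_nhds (0 : ℂ × ℂ) hr] with p hp
  refine (convex_ball (0 : ℂ × ℂ) r).is_const_of_fderivWithin_eq_zero (𝕜 := ℂ)
    (fun z hz => (hrh z hz).1.differentiableAt.differentiableWithinAt)
    (fun z hz => ?_) hp (Metric.mem_ball_self hr)
  rw [fderivWithin_of_isOpen Metric.isOpen_ball hz]
  refine ContinuousLinearMap.ext fun v => ?_
  have := fderiv_apply_eq_dz_dw h z v.1 v.2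
  rw [(hrh z hz).2.1, (hrh z hz).2.2] at this
  simpa using this

/-- A local biholomorphism and its local inverse are analytic with nonzero Jacobian. -/
lemma jacobian_ne_zero {Φ Θ : ℂ × ℂ → ℂ × ℂ} {p : ℂ × ℂ} (hΦ : AnalyticAt ℂ Φ p)
    (hΘ : AnalyticAt ℂ Θ (Φ p)) (h : ∀ᶠ q in 𝓝 p, Θ (Φ q) = q) :
    dz (fun q => (Φ q).1) p * dw (fun q => (Φ q).2) p
      - dw (fun q => (Φ q).1) p * dz (fun q => (Φ q).2) p ≠ 0 := by
  have hinj : ∀ v, fderiv ℂ Φ p v = 0 → v = 0 := by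
    intro v hv
    have h1 := hΘ.differentiableAt.hasFDerivAt.comp p hΦ.differentiableAt.hasFDerivAt
    have h2 : HasFDerivAt (Θ ∘ Φ) (ContinuousLinearMap.id ℂ (ℂ × ℂ)) p :=
      (hasFDerivAt_id p).congr_of_eventuallyEq h
    have h3 := congrArg (fun L : ℂ × ℂ →L[ℂ] ℂ × ℂ => L v) (h1.unique h2)
    simpa [hv] using h3.symm
  have hf : ∀ a b, fderiv ℂ Φ p (a, b) =
      (a * dz (fun q => (Φ q).1) p + b * dw (fun q => (Φ q).1) p,
       a * dz (fun q => (Φ q).2) p + b * dw (fun q => (Φ q).2) p) := by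
    intro a b
    rw [← fderiv_apply_eq_dz_dw, ← fderiv_apply_eq_dz_dw]
    have := hΦ.differentiableAt.hasFDerivAt
    rw [(this.fst).fderiv, (this.snd).fderiv]
    rfl
  intro h0
  generalize dz (fun q => (Φ q).1) p = A at *
  generalize dw (fun q => (Φ q).1) p = B at *
  generalize dz (fun q => (Φ q).2) p = C at *
  generalize dw (fun q => (Φ q).2) p = D at *
  have h1 := hinj (B, -A) (by
    rw [hf, Prod.mk_eq_zero]; exact ⟨by ring, by linear_combination -h0⟩)
  have h2 := hinj (D, -C) (by
    rw [hf, Prod.mk_eq_zero]; exact ⟨by linear_combination h0, by ring⟩)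
  simp only [Prod.mk_eq_zero, neg_eq_zero] at h1 h2
  have h3 := hinj (1, 0) (by rw [hf]; simp [h1, h2])
  simp at h3

lemma IsLocalBiholomorphismAt.analyticAt {Φ : ℂ × ℂ → ℂ × ℂ} {p : ℂ × ℂ}
    (h : IsLocalBiholomorphismAt Φ p) : AnalyticAt ℂ Φ p := by
  obtain ⟨e, hp, he, ha, -⟩ := h
  exact (ha p hp).congr he.symm

lemma IsLocalBiholomorphismAt.exists_inverse {Φ : ℂ × ℂ → ℂ × ℂ} {p : ℂ × ℂ}
    (h : IsLocalBiholomorphismAt Φ p) : ∃ Θ : ℂ × ℂ → ℂ × ℂ, AnalyticAt ℂ Θ (Φ p) ∧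
      Θ (Φ p) = p ∧ (∀ᶠ q in 𝓝 p, Θ (Φ q) = q) ∧ ∀ᶠ q in 𝓝 (Φ p), Φ (Θ q) = q := by
  obtain ⟨e, hp, he, ha, hs⟩ := h
  have hep : Φ p = e p := he.self_of_nhds
  rw [hep]
  refine ⟨e.symm, hs _ (e.map_source hp), e.left_inv hp, ?_, ?_⟩
  · filter_upwards [he, e.open_source.mem_nhds hp] with q hq hqs
    rw [hq, e.left_inv hqs]
  · have ht : Tendsto e.symm (𝓝 (e p)) (𝓝 p) := by
      simpa [e.left_inv hp] using (hs _ (e.map_source hp)).continuousAt.tendsto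
    filter_upwards [ht.eventually he, e.open_target.mem_nhds (e.map_source hp)] with q hq hqs
    rw [hq, e.right_inv hqs]

lemma IsLocalBiholomorphismAt.jacobian_ne_zero {Φ : ℂ × ℂ → ℂ × ℂ} {p : ℂ × ℂ}
    (h : IsLocalBiholomorphismAt Φ p) :
    dz (fun q => (Φ q).1) p * dw (fun q => (Φ q).2) p
      - dw (fun q => (Φ q).1) p * dz (fun q => (Φ q).2) p ≠ 0 := by
  obtain ⟨Θ, h1, -, h2, -⟩ := h.exists_inverse
  exact _root_.jacobian_ne_zero h.analyticAt h1 h2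

lemma eventually_fst {α β : Type*} [TopologicalSpace α] [TopologicalSpace β] {P : α × β → Prop}
    {x : α} {u : β} (h : ∀ᶠ p in 𝓝 (x, u), P p) : ∀ᶠ s in 𝓝 x, P (s, u) :=
  (show ContinuousAt (fun s => (s, u)) x by fun_prop).eventually h

lemma eventually_snd {α β : Type*} [TopologicalSpace α] [TopologicalSpace β] {P : α × β → Prop}
    {x : α} {u : β} (h : ∀ᶠ p in 𝓝 (x, u), P p) : ∀ᶠ s in 𝓝 u, P (x, s) :=
  (show ContinuousAt (fun s => (x, s)) u by fun_prop).eventually h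

lemma AnalyticAt.eventually_ne_of_not_flat {F : ℝ → ℝ} (hF : AnalyticAt ℝ F 0)
    (hn : ¬ F =ᶠ[𝓝 0] 0) : ∀ᶠ x in 𝓝 (0 : ℝ), x ≠ 0 → F x ≠ 0 :=
  eventually_nhdsWithin_iff.1 (hF.eventually_eq_zero_or_eventually_ne_zero.resolve_left hn)

lemma not_flat_deriv {F : ℝ → ℝ} (hF : AnalyticAt ℝ F 0) (hF0 : F 0 = 0)
    (hn : ¬ F =ᶠ[𝓝 0] 0) : ¬ deriv F =ᶠ[𝓝 0] 0 := by
  contrapose! hn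
  obtain ⟨r, hr, h⟩ := Metric.eventually_nhds_iff_ball.1 (hF.eventually_analyticAt.and hn)
  filter_upwards [Metric.ball_mem_nhds (0 : ℝ) hr] with x hx
  have := (convex_ball (0 : ℝ) r).is_const_of_fderivWithin_eq_zero (𝕜 := ℝ)
    (fun z hz => (h z hz).1.differentiableAt.differentiableWithinAt)
    (fun z hz => by
      rw [fderivWithin_of_isOpen Metric.isOpen_ball hz]
      ext; simpa using (h z hz).2) hx (Metric.mem_ball_self hr)
  simpa [hF0] using this

lemma eq_zero_of_punctured {φ : ℝ → ℂ} {x : ℝ} (hφ : ContinuousAt φ x)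
    (h : ∀ᶠ s in 𝓝 x, s ≠ x → φ s = 0) : φ x = 0 := by
  have h1 : Tendsto φ (𝓝[≠] x) (𝓝 (φ x)) := hφ.tendsto.mono_left nhdsWithin_le_nhds
  refine tendsto_nhds_unique (h1.congr' ?_) tendsto_const_nhds
  exact eventually_nhdsWithin_iff.2 h

lemma hasDerivAt_comp_curve_one {h : ℂ → ℂ} {z : ℝ → ℂ} {z' : ℂ} {t : ℝ}
    (hh : AnalyticAt ℂ h (z t)) (hz : HasDerivAt z z' t) :
    HasDerivAt (fun s => h (z s)) (z' * deriv h (z t)) t := by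
  have := (hh.differentiableAt.hasFDerivAt.restrictScalars ℝ).comp_hasDerivAt t hz
  simpa [Function.comp_def] using this

lemma deriv_eq_of_eventually_eq {φ ψ : ℝ → ℝ} {a b x : ℝ} (ha : HasDerivAt φ a x)
    (hb : HasDerivAt ψ b x) (h : ∀ᶠ s in 𝓝 x, φ s = ψ s) : a = b :=
  (ha.congr_of_eventuallyEq (EventuallyEq.symm h)).unique hb

/-- If the derivative of an analytic function is constant along the real line, the function is
affine. -/
lemma eventually_eq_linear {h : ℂ → ℂ} (hh : AnalyticAt ℂ h 0) (h0 : h 0 = 0)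
    (hd : ∀ᶠ u : ℝ in 𝓝 0, deriv h u = deriv h 0) : ∀ᶠ w in 𝓝 0, h w = deriv h 0 * w := by
  have h1 : (fun w => deriv h w - deriv h 0) =ᶠ[𝓝 0] 0 := by
    refine eventually_eq_zero_of_real_line (hh.deriv.sub analyticAt_const) one_ne_zero ?_
    filter_upwards [hd] with u hu
    simp [hu]
  obtain ⟨r, hr, hb⟩ := Metric.eventually_nhds_iff_ball.1 (hh.eventually_analyticAt.and h1)
  filter_upwards [Metric.ball_mem_nhds (0 : ℂ) hr] with x hx
  have hd : ∀ z ∈ Metric.ball (0 : ℂ) r,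
      HasDerivAt (fun w => h w - deriv h 0 * w) 0 z := by
    intro z hz
    have e := (hb z hz).2
    have := (hb z hz).1.differentiableAt.hasDerivAt.sub ((hasDerivAt_id z).const_mul (deriv h 0))
    rw [mul_one, show deriv h z - deriv h 0 = 0 from e] at this
    exact this
  have := (convex_ball (0 : ℂ) r).is_const_of_fderivWithin_eq_zero (𝕜 := ℂ)
    (fun z hz => (hd z hz).differentiableAt.differentiableWithinAt)
    (fun z hz => by
      rw [fderivWithin_of_isOpen Metric.isOpen_ball hz]
      ext; simpa using (hd z hz).deriv) hx (Metric.mem_ball_self hr)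
  simpa [h0, sub_eq_zero] using this

/-- The derivative of `x ↦ u + i F(x)` and of `u ↦ u + i F(x)`. -/
lemma hasDerivAt_graph_fst {F : ℝ → ℝ} {x : ℝ} (hF : DifferentiableAt ℝ F x) (u : ℝ) :
    HasDerivAt (fun s : ℝ => (u : ℂ) + F s * Complex.I) (deriv F x * Complex.I) x := by
  have := ((hF.hasDerivAt.ofReal_comp).mul_const Complex.I).const_add (u : ℂ)
  exact this

lemma hasDerivAt_graph_snd (c : ℂ) (u : ℝ) :
    HasDerivAt (fun s : ℝ => (s : ℂ) + c) 1 u := by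
  simpa using (Complex.ofRealCLM.hasDerivAt (x := u)).add_const c

section OneVariable

variable {F G : ℝ → ℝ} {γ q : ℂ → ℂ} {a : ℝ}

lemma tendsto_graph (hF : AnalyticAt ℝ F 0) (hF0 : F 0 = 0) :
    Tendsto (fun p : ℝ × ℝ => (p.2 : ℂ) + F p.1 * Complex.I) (𝓝 0) (𝓝 0) := by
  have h1 : ContinuousAt (fun p : ℝ × ℝ => (p.2 : ℂ) + F p.1 * Complex.I) 0 := by
    have : ContinuousAt (fun p : ℝ × ℝ => F p.1) 0 :=
      ContinuousAt.comp (f := Prod.fst) (g := F) hF.continuousAt continuousAt_fst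
    fun_prop
  simpa [ContinuousAt, hF0] using h1

lemma tendsto_im_div (hF : AnalyticAt ℝ F 0) (hF0 : F 0 = 0) (hFn : ¬ F =ᶠ[𝓝 0] 0) {u : ℝ}
    (hγ : AnalyticAt ℂ γ u) (hu : (γ u).im = 0) :
    Tendsto (fun x => (γ (u + F x * Complex.I)).im / F x) (𝓝[≠] 0) (𝓝 (deriv γ u).re) := by
  have h1 : HasDerivAt (fun s : ℝ => (γ (u + s * Complex.I)).im) (deriv γ u).re 0 := by
    have hz : HasDerivAt (fun s : ℝ => (u : ℂ) + s * Complex.I) Complex.I 0 := by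
      simpa using ((Complex.ofRealCLM.hasDerivAt (x := 0)).mul_const Complex.I).const_add (u : ℂ)
    have := hasDerivAt_im (hasDerivAt_comp_curve_one (h := γ) (by simpa using hγ) hz)
    simpa using this
  have h2 := hasDerivAt_iff_tendsto_slope.1 h1
  have h3 : Tendsto F (𝓝[≠] 0) (𝓝[≠] 0) := by
    refine tendsto_nhdsWithin_iff.2 ⟨?_, ?_⟩
    · simpa [hF0] using hF.continuousAt.tendsto.mono_left nhdsWithin_le_nhds
    · exact eventually_nhdsWithin_iff.2 (hF.eventually_ne_of_not_flat hFn)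
  refine (h2.comp h3).congr fun x => ?_
  simp [slope_def_field, hu]

lemma exists_tendsto_div_pow (hG : AnalyticAt ℝ G 0) (hGn : ¬ G =ᶠ[𝓝 0] 0) :
    ∃ (m : ℕ) (C : ℝ), C ≠ 0 ∧ ∀ (σ : ℝ → ℝ) (a : ℝ), σ 0 = 0 → HasDerivAt σ a 0 →
      Tendsto (fun x => G (σ x) / x ^ m) (𝓝[≠] 0) (𝓝 (a ^ m * C)) := by
  obtain ⟨m, G₁, h1, h2, h3⟩ := hG.exists_eventuallyEq_pow_smul_nonzero_iff.2 hGn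
  refine ⟨m, G₁ 0, h2, fun σ a h0 hσ => ?_⟩
  have hs : Tendsto σ (𝓝 0) (𝓝 0) := by simpa [h0] using hσ.continuousAt.tendsto
  have t1 : Tendsto (fun x => G₁ (σ x)) (𝓝[≠] 0) (𝓝 (G₁ 0)) :=
    (h1.continuousAt.tendsto.comp hs).mono_left nhdsWithin_le_nhds
  have t2 := hasDerivAt_iff_tendsto_slope.1 hσ
  refine ((t2.pow m).mul t1).congr' ?_
  filter_upwards [(hs.eventually h3).filter_mono nhdsWithin_le_nhds] with x hx
  rw [hx]
  simp [slope_def_field, h0, div_pow]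
  ring

/-- A map `(a z + q(w), γ(w))` of tubes is linear. -/
theorem linear_of_semilinear (hF : AnalyticAt ℝ F 0) (hF0 : F 0 = 0) (hF1 : deriv F 0 = 0)
    (hFn : ¬ F =ᶠ[𝓝 0] 0) (hG : AnalyticAt ℝ G 0) (hG0 : G 0 = 0) (hGn : ¬ G =ᶠ[𝓝 0] 0)
    (hγ : AnalyticAt ℂ γ 0) (hγ0 : γ 0 = 0) (hγ1 : deriv γ 0 ≠ 0)
    (hq : AnalyticAt ℂ q 0) (hq0 : q 0 = 0) (hqre : ∀ᶠ u : ℝ in 𝓝 0, (q u).re = 0) (ha : a ≠ 0)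
    (hE : ∀ᶠ p : ℝ × ℝ in 𝓝 0, (γ (p.2 + F p.1 * Complex.I)).im
      = G (a * p.1 + (q (p.2 + F p.1 * Complex.I)).re))
    (hne : ∀ᶠ p : ℝ × ℝ in 𝓝 0, p.1 ≠ 0 → a * p.1 + (q (p.2 + F p.1 * Complex.I)).re ≠ 0) :
    ∃ b c : ℝ, c ≠ 0 ∧ (∀ᶠ w in 𝓝 0, γ w = c * w) ∧
      ∀ᶠ w in 𝓝 0, q w = Complex.I * b * w := by
  have of_real : Tendsto (fun u : ℝ => (u : ℂ)) (𝓝 0) (𝓝 0) := by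
    simpa using (Complex.continuous_ofReal.tendsto 0)
  have line : Tendsto (fun u : ℝ => ((0 : ℝ), u)) (𝓝 0) (𝓝 0) :=
    (show Continuous (fun u : ℝ => ((0 : ℝ), u)) by fun_prop).tendsto 0
  have hE' := line.eventually (eventually_eventually_nhds.2 hE)
  have him : ∀ᶠ u : ℝ in 𝓝 0, (γ u).im = 0 := by
    filter_upwards [hE', hqre] with u hu hqu
    simpa [hF0, hqu, hG0] using hu.self_of_nhds
  have hdim : ∀ᶠ u : ℝ in 𝓝 0, (deriv γ u).im = 0 := by
    filter_upwards [eventually_eventually_nhds.2 him,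
      of_real.eventually hγ.eventually_analyticAt] with u hu hau
    have h1 := hasDerivAt_im (hasDerivAt_comp_curve_one
      (z := fun s : ℝ => (s : ℂ)) hau (Complex.ofRealCLM.hasDerivAt (x := u)))
    simpa using deriv_eq_of_eventually_eq h1 (hasDerivAt_const u 0) hu
  obtain ⟨m, C, hC, hlim⟩ := exists_tendsto_div_pow hG hGn
  have hlim' : ∀ᶠ u : ℝ in 𝓝 0, Tendsto (fun x => (γ (u + F x * Complex.I)).im / x ^ m)
      (𝓝[≠] 0) (𝓝 (a ^ m * C)) := by
    filter_upwards [hE', hqre, of_real.eventually hq.eventually_analyticAt] with u hu hqu hau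
    have hσ : HasDerivAt (fun x => a * x + (q (u + F x * Complex.I)).re) a 0 := by
      have h1 := hasDerivAt_re (hasDerivAt_comp_curve_one (h := q) (by simpa [hF0] using hau)
        (hasDerivAt_graph_fst hF.differentiableAt u))
      have h2 := ((hasDerivAt_id (0 : ℝ)).const_mul a).add h1
      simp only [hF1, Complex.ofReal_zero, zero_mul, Complex.zero_re, add_zero, mul_one] at h2
      exact h2
    refine (hlim _ a (by simp [hF0, hqu]) hσ).congr' ?_
    filter_upwards [(eventually_fst hu).filter_mono nhdsWithin_le_nhds] with x hx
    rw [← hx]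
  have hγ1' : (deriv γ 0).re ≠ 0 := by
    intro h
    have := hdim.self_of_nhds
    exact hγ1 (Complex.ext h (by simpa using this))
  have hγconst : ∀ᶠ u : ℝ in 𝓝 0, deriv γ u = deriv γ 0 := by
    filter_upwards [hdim, him, of_real.eventually hγ.eventually_analyticAt, hlim']
      with u hd hi hau hl
    have e1 := tendsto_im_div hF hF0 hFn hau hi
    have e0 := tendsto_im_div hF hF0 hFn (u := 0) (by simpa using hγ) (by simp [hγ0])
    have l0 := hlim'.self_of_nhds
    have hnz : a ^ m * C ≠ 0 := mul_ne_zero (pow_ne_zero _ ha) hC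
    have q1 := hl.div l0 hnz
    have q2 := e1.div e0 (by simpa using hγ1')
    rw [div_self hnz] at q1
    have : (deriv γ u).re / (deriv γ (0 : ℝ)).re = 1 := by
      refine tendsto_nhds_unique (q2.congr' ?_) q1
      filter_upwards [eventually_nhdsWithin_iff.2 (hF.eventually_ne_of_not_flat hFn),
        self_mem_nhdsWithin] with x hx hx0
      have : x ^ m ≠ 0 := pow_ne_zero _ hx0
      simp only [Pi.div_apply]
      rw [div_div_div_cancel_right₀ hx, div_div_div_cancel_right₀ this]
    rw [div_eq_one_iff_eq (by simpa using hγ1')] at this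
    refine Complex.ext (by simpa using this) ?_
    rw [hd]
    simpa using hdim.self_of_nhds.symm
  have hγlin := eventually_eq_linear hγ hγ0 hγconst
  have hc : deriv γ 0 = ((deriv γ 0).re : ℂ) :=
    Complex.ext rfl (by simpa using hdim.self_of_nhds)
  have tg := tendsto_graph hF hF0
  have hqd : ∀ᶠ p : ℝ × ℝ in 𝓝 0, p.1 ≠ 0 →
      (deriv q (p.2 + F p.1 * Complex.I)).re = 0 := by
    have hσ0 : Tendsto (fun p : ℝ × ℝ => a * p.1 + (q (p.2 + F p.1 * Complex.I)).re)
        (𝓝 0) (𝓝 0) := by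
      have h1 : Tendsto (fun p : ℝ × ℝ => (q (p.2 + F p.1 * Complex.I)).re) (𝓝 0) (𝓝 0) := by
        have := (Complex.continuous_re.tendsto (q 0)).comp (hq.continuousAt.tendsto.comp tg)
        simpa [hq0, Function.comp_def] using this
      have h2 : Tendsto (fun p : ℝ × ℝ => a * p.1) (𝓝 0) (𝓝 0) := by
        simpa using (show Continuous (fun p : ℝ × ℝ => a * p.1) by fun_prop).tendsto 0
      simpa using h2.add h1
    have hG' := hG.deriv.eventually_ne_of_not_flat (not_flat_deriv hG hG0 hGn)
    filter_upwards [eventually_eventually_nhds.2 hE, hne, tg.eventually hq.eventually_analyticAt,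
      tg.eventually hγ.eventually_analyticAt, hσ0.eventually hG',
      hσ0.eventually hG.eventually_analyticAt, tg.eventually (eventually_eventually_nhds.2 hγlin)]
      with ⟨x, u⟩ h1 h2 h3 h4 h5 h6 h7 hx
    have d1 := hasDerivAt_im (hasDerivAt_comp_curve_one
      (z := fun s : ℝ => (s : ℂ) + F x * Complex.I) h4 (hasDerivAt_graph_snd _ u))
    have d2 := (hasDerivAt_re (hasDerivAt_comp_curve_one
      (z := fun s : ℝ => (s : ℂ) + F x * Complex.I) h3 (hasDerivAt_graph_snd _ u))).const_add (a * x)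
    have d3 := h6.differentiableAt.hasDerivAt.comp u d2
    have e := deriv_eq_of_eventually_eq d1 d3 (eventually_snd h1)
    have e7 : deriv γ (u + F x * Complex.I) = deriv γ 0 := by
      rw [EventuallyEq.deriv_eq (f := fun w => deriv γ 0 * w) h7]; simp
    rw [one_mul, one_mul, e7, hc, Complex.ofReal_im] at e
    exact (mul_eq_zero.1 e.symm).resolve_left (h5 (h2 hx))
  have hF' := hF.deriv.eventually_ne_of_not_flat (not_flat_deriv hF hF0 hFn)
  have hF'' : ∀ᶠ p : ℝ × ℝ in 𝓝 0, p.1 ≠ 0 → deriv F p.1 ≠ 0 :=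
    (continuous_fst.tendsto (0 : ℝ × ℝ)).eventually hF'
  have hFa : ∀ᶠ p : ℝ × ℝ in 𝓝 0, AnalyticAt ℝ F p.1 :=
    (continuous_fst.tendsto (0 : ℝ × ℝ)).eventually hF.eventually_analyticAt
  have hqdd : ∀ᶠ p : ℝ × ℝ in 𝓝 0, p.1 ≠ 0 →
      deriv (deriv q) (p.2 + F p.1 * Complex.I) = 0 := by
    filter_upwards [eventually_eventually_nhds.2 hqd, tg.eventually hq.eventually_analyticAt,
      hF'', hFa] with ⟨x, u⟩ h1 h2 h3 h4 hx
    have d1 := hasDerivAt_re (hasDerivAt_comp_curve_one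
      (z := fun s : ℝ => (s : ℂ) + F x * Complex.I) h2.deriv (hasDerivAt_graph_snd _ u))
    have d2 := hasDerivAt_re (hasDerivAt_comp_curve_one
      (z := fun s : ℝ => (u : ℂ) + F s * Complex.I) h2.deriv
      (hasDerivAt_graph_fst h4.differentiableAt u))
    have e1 := deriv_eq_of_eventually_eq d1 (hasDerivAt_const u 0)
      ((eventually_snd h1).mono fun s hs => hs hx)
    have e2 := deriv_eq_of_eventually_eq d2 (hasDerivAt_const x 0) (by
      filter_upwards [eventually_fst h1, eventually_ne_nhds hx] with s hs hs0 using hs hs0)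
    refine Complex.ext (by simpa using e1) ?_
    simpa [h3 hx] using e2
  have hqdd0 : ∀ᶠ u : ℝ in 𝓝 0, deriv (deriv q) u = 0 := by
    filter_upwards [line.eventually (eventually_eventually_nhds.2 hqdd),
      of_real.eventually hq.eventually_analyticAt] with u h1 h2
    have hc : ContinuousAt (fun x : ℝ => deriv (deriv q) (u + F x * Complex.I)) 0 := by
      refine ContinuousAt.comp (g := deriv (deriv q)) ?_
        (hasDerivAt_graph_fst hF.differentiableAt u).continuousAt
      simpa [hF0] using h2.deriv.deriv.continuousAt
    simpa [hF0] using eq_zero_of_punctured hc (eventually_fst h1)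
  have hqconst : ∀ᶠ u : ℝ in 𝓝 0, deriv q u = deriv q 0 := by
    have h1 := eventually_eq_zero_of_real_line hq.deriv.deriv one_ne_zero
      (hqdd0.mono fun u hu => by simpa using hu)
    obtain ⟨r, hr, h⟩ := Metric.eventually_nhds_iff_ball.1
      (hq.deriv.eventually_analyticAt.and h1)
    refine of_real.eventually (p := fun w => deriv q w = deriv q 0) ?_
    filter_upwards [Metric.ball_mem_nhds (0 : ℂ) hr] with x hx
    exact (convex_ball (0 : ℂ) r).is_const_of_fderivWithin_eq_zero (𝕜 := ℂ)
      (fun z hz => (h z hz).1.differentiableAt.differentiableWithinAt)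
      (fun z hz => by
        rw [fderivWithin_of_isOpen Metric.isOpen_ball hz]
        ext; simpa using (h z hz).2) hx (Metric.mem_ball_self hr)
  have hqr : (deriv q 0).re = 0 := by
    have h1 := hasDerivAt_re (hasDerivAt_comp_curve_one (h := q) (z := fun s : ℝ => (s : ℂ) + 0)
      (t := 0) (by simpa using hq) (hasDerivAt_graph_snd 0 0))
    simpa using deriv_eq_of_eventually_eq h1 (hasDerivAt_const (0 : ℝ) (0 : ℝ))
      (by simpa using hqre)
  refine ⟨(deriv q 0).im, (deriv γ 0).re, hγ1', ?_, ?_⟩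
  · filter_upwards [hγlin] with w hw
    rw [hw, ← hc]
  · filter_upwards [eventually_eq_linear hq hq0 hqconst] with w hw
    rw [hw]
    congr 1
    exact Complex.ext (by simp [hqr]) (by simp)

end OneVariable

/-- The parametrization `(x, y, u) ↦ (x + i y, u + i F(x))` of the tube over `F`. -/
noncomputable def tubePoint (F : ℝ → ℝ) (t : ℝ × ℝ × ℝ) : ℂ × ℂ :=
  ((t.1 : ℂ) + t.2.1 * Complex.I, (t.2.2 : ℂ) + F t.1 * Complex.I)

section TubeMap

variable {F G : ℝ → ℝ} {f g h : ℂ × ℂ → ℂ}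

lemma tendsto_tubePoint (hF : AnalyticAt ℝ F 0) (hF0 : F 0 = 0) :
    Tendsto (tubePoint F) (𝓝 0) (𝓝 0) := by
  have h1 : ContinuousAt (tubePoint F) 0 := by
    have : ContinuousAt (fun p : ℝ × ℝ × ℝ => F p.1) 0 :=
      ContinuousAt.comp (f := Prod.fst) (g := F) hF.continuousAt continuousAt_fst
    unfold tubePoint
    fun_prop
  have e : tubePoint F 0 = 0 := by simp [tubePoint, hF0]
  rwa [ContinuousAt, e] at h1

lemma hasDerivAt_tube_x {x y u : ℝ} (hF : DifferentiableAt ℝ F x)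
    (hh : AnalyticAt ℂ h (tubePoint F (x, y, u))) :
    HasDerivAt (fun s => h (tubePoint F (s, y, u)))
      (dz h (tubePoint F (x, y, u)) + deriv F x * Complex.I * dw h (tubePoint F (x, y, u))) x := by
  have := hasDerivAt_comp_curve (z := fun s : ℝ => (s : ℂ) + y * Complex.I)
    (w := fun s : ℝ => (u : ℂ) + F s * Complex.I) hh (hasDerivAt_graph_snd _ x)
    (hasDerivAt_graph_fst hF u)
  rwa [one_mul] at this

lemma hasDerivAt_tube_y {x y u : ℝ} (hh : AnalyticAt ℂ h (tubePoint F (x, y, u))) :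
    HasDerivAt (fun s => h (tubePoint F (x, s, u)))
      (Complex.I * dz h (tubePoint F (x, y, u))) y := by
  have hz : HasDerivAt (fun s : ℝ => (x : ℂ) + s * Complex.I) Complex.I y := by
    simpa using ((Complex.ofRealCLM.hasDerivAt (x := y)).mul_const Complex.I).const_add (x : ℂ)
  have := hasDerivAt_comp_curve (z := fun s : ℝ => (x : ℂ) + s * Complex.I)
    (w := fun s : ℝ => (u : ℂ) + F x * Complex.I) hh hz (hasDerivAt_const y _)
  rwa [zero_mul, add_zero] at this

lemma hasDerivAt_tube_u {x y u : ℝ} (hh : AnalyticAt ℂ h (tubePoint F (x, y, u))) :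
    HasDerivAt (fun s => h (tubePoint F (x, y, s))) (dw h (tubePoint F (x, y, u))) u := by
  have := hasDerivAt_comp_curve (z := fun s : ℝ => (x : ℂ) + y * Complex.I)
    (w := fun s : ℝ => (s : ℂ) + F x * Complex.I) hh (hasDerivAt_const u _)
    (hasDerivAt_graph_snd _ u)
  rwa [zero_mul, zero_add, one_mul] at this

lemma eventually_x {Q : ℝ × ℝ × ℝ → Prop} {x y u : ℝ} (hQ : ∀ᶠ t in 𝓝 (x, y, u), Q t) :
    ∀ᶠ s in 𝓝 x, Q (s, y, u) := eventually_fst hQ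

lemma eventually_y {Q : ℝ × ℝ × ℝ → Prop} {x y u : ℝ} (hQ : ∀ᶠ t in 𝓝 (x, y, u), Q t) :
    ∀ᶠ s in 𝓝 y, Q (x, s, u) := eventually_fst (P := fun r : ℝ × ℝ => Q (x, r)) (eventually_snd hQ)

lemma eventually_u {Q : ℝ × ℝ × ℝ → Prop} {x y u : ℝ} (hQ : ∀ᶠ t in 𝓝 (x, y, u), Q t) :
    ∀ᶠ s in 𝓝 u, Q (x, y, s) := eventually_snd (P := fun r : ℝ × ℝ => Q (x, r)) (eventually_snd hQ)

lemma eventually_slice {Q : ℝ × ℝ × ℝ → Prop} (hQ : ∀ᶠ t in 𝓝 0, Q t) :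
    ∀ᶠ r : ℝ × ℝ in 𝓝 0, ∀ᶠ t in 𝓝 ((0 : ℝ), r), Q t :=
  eventually_snd (x := (0 : ℝ)) (u := (0 : ℝ × ℝ)) (eventually_eventually_nhds.2 hQ)

lemma tubePoint_slice (hF0 : F 0 = 0) (r : ℝ × ℝ) :
    tubePoint F (0, r) = (r.1 * Complex.I, (r.2 : ℂ)) := by simp [tubePoint, hF0]

lemma tendsto_re_comp_tubePoint (hF : AnalyticAt ℝ F 0) (hF0 : F 0 = 0) (hf : AnalyticAt ℂ f 0)
    (hf0 : f 0 = 0) : Tendsto (fun t => (f (tubePoint F t)).re) (𝓝 0) (𝓝 0) := by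
  have := (Complex.continuous_re.tendsto (f 0)).comp
    (hf.continuousAt.tendsto.comp (tendsto_tubePoint hF hF0))
  simpa [hf0, Function.comp_def] using this

lemma tube_eq_dy (hF : AnalyticAt ℝ F 0) (hF0 : F 0 = 0) (hG : AnalyticAt ℝ G 0)
    (hf : AnalyticAt ℂ f 0) (hf0 : f 0 = 0) (hg : AnalyticAt ℂ g 0)
    (hR : ∀ᶠ t in 𝓝 0, (g (tubePoint F t)).im = G (f (tubePoint F t)).re) :
    ∀ᶠ t in 𝓝 0, (dz g (tubePoint F t)).re
      = -(deriv G (f (tubePoint F t)).re * (dz f (tubePoint F t)).im) := by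
  have tp := tendsto_tubePoint hF hF0
  filter_upwards [eventually_eventually_nhds.2 hR, tp.eventually hf.eventually_analyticAt,
    tp.eventually hg.eventually_analyticAt,
    (tendsto_re_comp_tubePoint hF hF0 hf hf0).eventually hG.eventually_analyticAt]
    with ⟨x, y, u⟩ h1 h2 h3 h4
  have d1 := hasDerivAt_im (hasDerivAt_tube_y h3)
  have d2 := h4.differentiableAt.hasDerivAt.comp y (hasDerivAt_re (hasDerivAt_tube_y h2))
  have := deriv_eq_of_eventually_eq d1 d2 (eventually_y h1)
  simpa using this

lemma tube_eq_dx (hF : AnalyticAt ℝ F 0) (hF0 : F 0 = 0) (hG : AnalyticAt ℝ G 0)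
    (hf : AnalyticAt ℂ f 0) (hf0 : f 0 = 0) (hg : AnalyticAt ℂ g 0)
    (hR : ∀ᶠ t in 𝓝 0, (g (tubePoint F t)).im = G (f (tubePoint F t)).re) :
    ∀ᶠ t : ℝ × ℝ × ℝ in 𝓝 0,
      (dz g (tubePoint F t)).im + deriv F t.1 * (dw g (tubePoint F t)).re
      = deriv G (f (tubePoint F t)).re *
        ((dz f (tubePoint F t)).re - deriv F t.1 * (dw f (tubePoint F t)).im) := by
  have tp := tendsto_tubePoint hF hF0
  filter_upwards [eventually_eventually_nhds.2 hR, tp.eventually hf.eventually_analyticAt,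
    tp.eventually hg.eventually_analyticAt,
    (tendsto_re_comp_tubePoint hF hF0 hf hf0).eventually hG.eventually_analyticAt,
    (continuous_fst.tendsto (0 : ℝ × ℝ × ℝ)).eventually hF.eventually_analyticAt]
    with ⟨x, y, u⟩ h1 h2 h3 h4 h5
  have hFx : DifferentiableAt ℝ F x := h5.differentiableAt
  have d1 := hasDerivAt_im (hasDerivAt_tube_x hFx h3)
  have d2 := h4.differentiableAt.hasDerivAt.comp x (hasDerivAt_re (hasDerivAt_tube_x hFx h2))
  have := deriv_eq_of_eventually_eq d1 d2 (eventually_x h1)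
  simpa [sub_eq_add_neg] using this

/-- A map of tubes preserves the vanishing of the Levi form on the slice `x = 0`. -/
lemma deriv_deriv_eq_zero_on_slice (hF : AnalyticAt ℝ F 0) (hF0 : F 0 = 0) (hF1 : deriv F 0 = 0)
    (hF2 : deriv (deriv F) 0 = 0) (hG : AnalyticAt ℝ G 0)
    (hf : AnalyticAt ℂ f 0) (hf0 : f 0 = 0) (hf1 : dz f 0 ≠ 0) (hg : AnalyticAt ℂ g 0)
    (hR : ∀ᶠ t in 𝓝 0, (g (tubePoint F t)).im = G (f (tubePoint F t)).re) :
    ∀ᶠ r : ℝ × ℝ in 𝓝 0, deriv (deriv G) (f (tubePoint F (0, r))).re = 0 := by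
  have tp := tendsto_tubePoint hF hF0
  have hne : ∀ᶠ p in 𝓝 (0 : ℂ × ℂ), dz f p ≠ 0 :=
    (analyticAt_dz hf).continuousAt.eventually_ne hf1
  filter_upwards [eventually_slice (tube_eq_dy hF hF0 hG hf hf0 hg hR),
    eventually_slice (tube_eq_dx hF hF0 hG hf hf0 hg hR),
    eventually_slice (tp.eventually hf.eventually_analyticAt),
    eventually_slice (tp.eventually hg.eventually_analyticAt),
    eventually_slice
      ((tendsto_re_comp_tubePoint hF hF0 hf hf0).eventually hG.eventually_analyticAt),
    eventually_slice (tp.eventually hne)] with ⟨y, u⟩ hy hx haf hag haG hn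
  replace haf := haf.self_of_nhds
  replace hag := hag.self_of_nhds
  replace haG := haG.self_of_nhds
  replace hn := hn.self_of_nhds
  have hFd := hF.differentiableAt
  have hF'd := hF.deriv.differentiableAt.hasDerivAt
  have G' := haG.deriv.differentiableAt.hasDerivAt
  have ey := deriv_eq_of_eventually_eq
    (hasDerivAt_re (hasDerivAt_tube_y (analyticAt_dz hag)))
    (((G'.comp (h₂ := deriv G) y (hasDerivAt_re (hasDerivAt_tube_y haf))).mul
      (hasDerivAt_im (hasDerivAt_tube_y (analyticAt_dz haf)))).neg) (eventually_y hy)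
  have ex := deriv_eq_of_eventually_eq
    ((hasDerivAt_im (hasDerivAt_tube_x hFd (analyticAt_dz hag))).add
      (hF'd.mul (hasDerivAt_re (hasDerivAt_tube_x hFd (analyticAt_dw hag)))))
    ((G'.comp (h₂ := deriv G) 0 (hasDerivAt_re (hasDerivAt_tube_x hFd haf))).mul
      ((hasDerivAt_re (hasDerivAt_tube_x hFd (analyticAt_dz haf))).sub
        (hF'd.mul (hasDerivAt_im (hasDerivAt_tube_x hFd (analyticAt_dw haf))))))
    (eventually_x hx)
  simp only [Function.comp_apply, Pi.sub_apply, Pi.mul_apply, hF1, hF2,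
    Complex.ofReal_zero, zero_mul, add_zero, sub_zero,
    Complex.mul_re, Complex.mul_im, Complex.I_re, Complex.I_im, one_mul, zero_sub, zero_add]
    at ex ey
  have key : deriv (deriv G) (f (tubePoint F (0, y, u))).re
      * Complex.normSq (dz f (tubePoint F (0, y, u))) = 0 := by
    rw [Complex.normSq_apply]
    linarith
  exact (mul_eq_zero.1 key).resolve_right (by simpa using hn)

lemma ne_zero_of_hasDerivAt_ne_zero {φ φ' : ℝ → ℝ} {ε : ℝ}
    (hd : ∀ s, |s| < ε → HasDerivAt φ (φ' s) s) (hne : ∀ s, |s| < ε → φ' s ≠ 0) (h0 : φ 0 = 0)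
    {x : ℝ} (hx : |x| < ε) (hx0 : x ≠ 0) : φ x ≠ 0 := by
  intro hφ
  have hx' := abs_lt.1 hx
  rcases lt_or_gt_of_ne hx0 with h | h
  · have hs : ∀ s ∈ Set.Icc x 0, |s| < ε :=
      fun s hs => abs_lt.2 ⟨by linarith [hs.1], by linarith [hs.2]⟩
    obtain ⟨s, hs1, hs2⟩ := exists_hasDerivAt_eq_zero h
      (fun s hs' => (hd s (hs s hs')).continuousAt.continuousWithinAt) (by rw [hφ, h0])
      (fun s hs' => hd s (hs s (Set.Ioo_subset_Icc_self hs')))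
    exact hne s (hs s (Set.Ioo_subset_Icc_self hs1)) hs2
  · have hs : ∀ s ∈ Set.Icc 0 x, |s| < ε :=
      fun s hs => abs_lt.2 ⟨by linarith [hs.1], by linarith [hs.2]⟩
    obtain ⟨s, hs1, hs2⟩ := exists_hasDerivAt_eq_zero h
      (fun s hs' => (hd s (hs s hs')).continuousAt.continuousWithinAt) (by rw [hφ, h0])
      (fun s hs' => hd s (hs s (Set.Ioo_subset_Icc_self hs')))
    exact hne s (hs s (Set.Ioo_subset_Icc_self hs1)) hs2

/-- If `Re f` vanishes on the slice `x = 0` and its derivative across the slice does not vanish at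
the origin, then `Re f ≠ 0` off the slice. -/
lemma re_ne_zero_off_slice (hF : AnalyticAt ℝ F 0) (hF0 : F 0 = 0) (hF1 : deriv F 0 = 0)
    (hf : AnalyticAt ℂ f 0) (hf1 : (dz f 0).re ≠ 0)
    (h0 : ∀ᶠ r : ℝ × ℝ in 𝓝 0, (f (tubePoint F (0, r))).re = 0) :
    ∀ᶠ t : ℝ × ℝ × ℝ in 𝓝 0, t.1 ≠ 0 → (f (tubePoint F t)).re ≠ 0 := by
  have tp := tendsto_tubePoint hF hF0
  have tF : ∀ᶠ t : ℝ × ℝ × ℝ in 𝓝 0, AnalyticAt ℝ F t.1 :=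
    (continuous_fst.tendsto (0 : ℝ × ℝ × ℝ)).eventually hF.eventually_analyticAt
  have hne : ∀ᶠ t : ℝ × ℝ × ℝ in 𝓝 0, (dz f (tubePoint F t)
      + deriv F t.1 * Complex.I * dw f (tubePoint F t)).re ≠ 0 := by
    have c1 := (analyticAt_dz hf).continuousAt.tendsto.comp tp
    have c2 := (analyticAt_dw hf).continuousAt.tendsto.comp tp
    have c3 : Tendsto (fun t : ℝ × ℝ × ℝ => ((deriv F t.1 : ℝ) : ℂ)) (𝓝 0) (𝓝 0) := by
      have := (Complex.continuous_ofReal.tendsto _).comp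
        (hF.deriv.continuousAt.tendsto.comp (continuous_fst.tendsto (0 : ℝ × ℝ × ℝ)))
      simpa [hF1, Function.comp_def] using this
    have c4 := (Complex.continuous_re.tendsto _).comp
      (c1.add ((c3.mul_const Complex.I).mul c2))
    refine c4.eventually_ne ?_
    simpa using hf1
  have h0' : ∀ᶠ t : ℝ × ℝ × ℝ in 𝓝 0, (f (tubePoint F (0, t.2))).re = 0 :=
    (continuous_snd.tendsto (0 : ℝ × ℝ × ℝ)).eventually h0
  obtain ⟨ε, hε, hb⟩ := Metric.eventually_nhds_iff_ball.1
    (((tp.eventually hf.eventually_analyticAt).and tF).and (hne.and h0'))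
  rw [show (0 : ℝ × ℝ × ℝ) = (0, 0) from rfl] at hb ⊢
  filter_upwards [Metric.ball_mem_nhds _ hε] with ⟨x, y, u⟩ ht hx
  rw [← ball_prod_same] at ht hb
  have mem : ∀ s : ℝ, |s| < ε → (s, y, u) ∈ Metric.ball (0 : ℝ) ε ×ˢ Metric.ball (0 : ℝ × ℝ) ε :=
    fun s hs => ⟨by simpa using hs, ht.2⟩
  refine ne_zero_of_hasDerivAt_ne_zero (φ := fun s => (f (tubePoint F (s, y, u))).re) (ε := ε)
    (fun s hs => hasDerivAt_re (hasDerivAt_tube_x ?_ ?_)) (fun s hs => ?_) ?_ (by simpa using ht.1) hx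
  · exact (hb _ (mem s hs)).1.2.differentiableAt
  · exact (hb _ (mem s hs)).1.1
  · exact (hb _ (mem s hs)).2.1
  · exact (hb _ (mem 0 (by simpa using hε))).2.2

/-- A holomorphic map between tubes with isolated Levi degeneracy at `x = 0` is linear. -/
theorem linear_of_tube_map (hF : AnalyticAt ℝ F 0) (hF0 : F 0 = 0) (hF1 : deriv F 0 = 0)
    (hF2 : deriv (deriv F) 0 = 0) (hFn : ¬ F =ᶠ[𝓝 0] 0)
    (hG : AnalyticAt ℝ G 0) (hG0 : G 0 = 0) (hG1 : deriv G 0 = 0) (hGn : ¬ G =ᶠ[𝓝 0] 0)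
    (hf : AnalyticAt ℂ f 0) (hf0 : f 0 = 0) (hg : AnalyticAt ℂ g 0) (hg0 : g 0 = 0)
    (hJ : dz f 0 * dw g 0 - dw f 0 * dz g 0 ≠ 0)
    (hR : ∀ᶠ t in 𝓝 0, (g (tubePoint F t)).im = G (f (tubePoint F t)).re) :
    ∃ a b c : ℝ, a ≠ 0 ∧ c ≠ 0 ∧
      ∀ᶠ p in 𝓝 (0 : ℂ × ℂ), f p = a * p.1 + Complex.I * b * p.2 ∧ g p = c * p.2 := by
  have tp := tendsto_tubePoint hF hF0
  have tp0 : tubePoint F 0 = 0 := by simp [tubePoint, hF0]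
  have tf := tendsto_re_comp_tubePoint hF hF0 hf hf0
  have hdy := tube_eq_dy hF hF0 hG hf hf0 hg hR
  have hdx := tube_eq_dx hF hF0 hG hf hf0 hg hR
  have hG' := not_flat_deriv hG hG0 hGn
  have hG'' := not_flat_deriv hG.deriv hG1 hG'
  have hF' := hF.deriv.eventually_ne_of_not_flat (not_flat_deriv hF hF0 hFn)
  have sl : Tendsto (fun r : ℝ × ℝ => ((0 : ℝ), r)) (𝓝 0) (𝓝 0) :=
    (show Continuous (fun r : ℝ × ℝ => ((0 : ℝ), r)) by fun_prop).tendsto 0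
  have hgz0 : dz g 0 = 0 := by
    have h1 := hdy.self_of_nhds
    have h2 := hdx.self_of_nhds
    simp only [tp0, hf0, Complex.zero_re, hG1, hF1, Prod.fst_zero, zero_mul, neg_zero,
      add_zero] at h1 h2
    exact Complex.ext h1 h2
  have hfz0 : dz f 0 ≠ 0 := fun h => hJ (by rw [h, hgz0]; ring)
  have hgw0 : dw g 0 ≠ 0 := fun h => hJ (by rw [h, hgz0]; ring)
  have hre : ∀ᶠ r : ℝ × ℝ in 𝓝 0, (f (tubePoint F (0, r))).re = 0 := by
    filter_upwards [deriv_deriv_eq_zero_on_slice hF hF0 hF1 hF2 hG hf hf0 hfz0 hg hR,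
      (tf.comp sl).eventually (hG.deriv.deriv.eventually_ne_of_not_flat hG'')] with r h1 h2
    by_contra h
    exact h2 h h1
  have hgz : dz g =ᶠ[𝓝 0] 0 := by
    refine eventually_eq_zero_of_totally_real (analyticAt_dz hg) ?_
    filter_upwards [hre, sl.eventually hdy, sl.eventually hdx] with r h0 h1 h2
    rw [← tubePoint_slice hF0 r]
    simp only [h0, hG1, hF1, zero_mul, neg_zero, add_zero] at h1 h2
    exact Complex.ext h1 h2
  have hfim : ∀ᶠ r : ℝ × ℝ in 𝓝 0, (dz f (tubePoint F (0, r))).im = 0 := by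
    filter_upwards [eventually_eventually_nhds.2 hre,
      sl.eventually (tp.eventually hf.eventually_analyticAt)] with ⟨y, u⟩ h1 h2
    simpa using deriv_eq_of_eventually_eq (hasDerivAt_re (hasDerivAt_tube_y h2))
      (hasDerivAt_const y 0) (eventually_fst h1)
  have hfim0 : (dz f 0).im = 0 := by
    have := hfim.self_of_nhds
    rwa [show ((0 : ℝ), (0 : ℝ × ℝ)) = 0 from rfl, tp0] at this
  have hfre0 : (dz f 0).re ≠ 0 := fun h => hfz0 (Complex.ext h hfim0)
  have hoff := re_ne_zero_off_slice hF hF0 hF1 hf hfre0 hre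
  have hfimM : ∀ᶠ t : ℝ × ℝ × ℝ in 𝓝 0, (dz f (tubePoint F t)).im = 0 := by
    filter_upwards [hoff, hdy, tf.eventually (hG.deriv.eventually_ne_of_not_flat hG'),
      tp.eventually hgz, (continuous_snd.tendsto (0 : ℝ × ℝ × ℝ)).eventually hfim]
      with ⟨x, r⟩ h1 h2 h3 h4 h5
    by_cases hx : x = 0
    · rw [hx]; exact h5
    · rw [h4, Pi.zero_apply, Complex.zero_re, eq_comm, neg_eq_zero] at h2
      exact (mul_eq_zero.1 h2).resolve_left (h3 (h1 hx))
  have hfz_an : ∀ᶠ t in 𝓝 0, AnalyticAt ℂ (dz f) (tubePoint F t) :=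
    (tp.eventually hf.eventually_analyticAt).mono fun t ht => analyticAt_dz ht
  have hfx : ∀ᶠ t : ℝ × ℝ × ℝ in 𝓝 0, (dz (dz f) (tubePoint F t)).im
      + deriv F t.1 * (dw (dz f) (tubePoint F t)).re = 0 := by
    filter_upwards [eventually_eventually_nhds.2 hfimM, hfz_an,
      (continuous_fst.tendsto (0 : ℝ × ℝ × ℝ)).eventually hF.eventually_analyticAt]
      with ⟨x, y, u⟩ h1 h2 h3
    simpa using deriv_eq_of_eventually_eq
      (hasDerivAt_im (hasDerivAt_tube_x (x := x) h3.differentiableAt h2))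
      (hasDerivAt_const x 0) (eventually_x h1)
  have hfy : ∀ᶠ t : ℝ × ℝ × ℝ in 𝓝 0, (dz (dz f) (tubePoint F t)).re = 0 := by
    filter_upwards [eventually_eventually_nhds.2 hfimM, hfz_an] with ⟨x, y, u⟩ h1 h2
    simpa using deriv_eq_of_eventually_eq (hasDerivAt_im (hasDerivAt_tube_y h2))
      (hasDerivAt_const y 0) (eventually_y h1)
  have hfu : ∀ᶠ t : ℝ × ℝ × ℝ in 𝓝 0, (dw (dz f) (tubePoint F t)).im = 0 := by
    filter_upwards [eventually_eventually_nhds.2 hfimM, hfz_an] with ⟨x, y, u⟩ h1 h2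
    exact deriv_eq_of_eventually_eq (hasDerivAt_im (hasDerivAt_tube_u h2))
      (hasDerivAt_const u 0) (eventually_u h1)
  have hfzz : dz (dz f) =ᶠ[𝓝 0] 0 := by
    refine eventually_eq_zero_of_totally_real (analyticAt_dz (analyticAt_dz hf)) ?_
    filter_upwards [sl.eventually hfx, sl.eventually hfy] with r h1 h2
    rw [← tubePoint_slice hF0 r]
    simp only [hF1, zero_mul, add_zero] at h1
    exact Complex.ext h2 h1
  have hfzw : dw (dz f) =ᶠ[𝓝 0] 0 := by
    have hpunct : ∀ᶠ t : ℝ × ℝ × ℝ in 𝓝 0, t.1 ≠ 0 → dw (dz f) (tubePoint F t) = 0 := by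
      filter_upwards [hfx, hfu, tp.eventually hfzz,
        (continuous_fst.tendsto (0 : ℝ × ℝ × ℝ)).eventually hF'] with t h1 h2 h3 h4 ht
      rw [h3, Pi.zero_apply, Complex.zero_im, zero_add] at h1
      exact Complex.ext ((mul_eq_zero.1 h1).resolve_left (h4 ht)) h2
    refine eventually_eq_zero_of_totally_real (analyticAt_dw (analyticAt_dz hf)) ?_
    filter_upwards [eventually_slice hpunct, sl.eventually hfz_an] with ⟨y, u⟩ h1 h2
    rw [← tubePoint_slice hF0 (y, u)]
    exact eq_zero_of_punctured
      (hasDerivAt_tube_x hF.differentiableAt (analyticAt_dw h2)).continuousAt (eventually_x h1)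
  have hfzc := eventually_eq_const_of_dz_dw_eq_zero (analyticAt_dz hf) hfzz hfzw
  set a : ℝ := (dz f 0).re
  have hfa : dz f 0 = a := Complex.ext rfl hfim0
  have hf_eq : ∀ᶠ p in 𝓝 (0 : ℂ × ℂ), f p = a * p.1 + f (0, p.2) := by
    have hl : AnalyticAt ℂ (fun p : ℂ × ℂ => (a : ℂ) * p.1) 0 :=
      analyticAt_const.mul analyticAt_fst
    have h1 : dz (fun p => f p - a * p.1) =ᶠ[𝓝 0] 0 := by
      filter_upwards [hfzc, hf.eventually_analyticAt] with p h1 h2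
      have h3 := h2.differentiableAt.hasFDerivAt.sub
        ((hasFDerivAt_fst (𝕜 := ℂ) (p := p)).const_mul (a : ℂ))
      rw [dz, HasFDerivAt.fderiv (f := fun p : ℂ × ℂ => f p - a * p.1) h3]
      have : fderiv ℂ f p (1, 0) = a := by rw [← hfa, ← h1]; rfl
      simp [this]
    filter_upwards [eventually_eq_of_dz_eq_zero (hf.sub hl) h1] with p hp
    simp only [Pi.sub_apply, mul_zero, sub_zero] at hp
    linear_combination hp
  have hg_eq := eventually_eq_of_dz_eq_zero hg hgz
  have hq : AnalyticAt ℂ (fun w => f (0, w)) 0 :=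
    AnalyticAt.comp₂ (h := f) hf analyticAt_const analyticAt_id
  have hγ : AnalyticAt ℂ (fun w => g (0, w)) 0 :=
    AnalyticAt.comp₂ (h := g) hg analyticAt_const analyticAt_id
  have hγ1 : deriv (fun w => g (0, w)) 0 ≠ 0 := by
    have := hg.differentiableAt.hasFDerivAt.comp_hasDerivAt (0 : ℂ)
      ((hasDerivAt_const (0 : ℂ) (0 : ℂ)).prodMk (hasDerivAt_id (0 : ℂ)))
    rw [show (fun w => g (0, w)) = g ∘ fun w => ((0 : ℂ), w) from rfl]
    exact this.deriv.trans_ne hgw0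
  have s2 : Tendsto (fun p : ℝ × ℝ => (p.1, (0 : ℝ), p.2)) (𝓝 0) (𝓝 0) :=
    (show Continuous (fun p : ℝ × ℝ => (p.1, (0 : ℝ), p.2)) by fun_prop).tendsto 0
  have hre_eq : ∀ᶠ t : ℝ × ℝ in 𝓝 0, (f (tubePoint F (t.1, 0, t.2))).re
      = a * t.1 + (f (0, t.2 + F t.1 * Complex.I)).re := by
    filter_upwards [s2.eventually (tp.eventually hf_eq)] with t ht
    rw [ht]
    simp [tubePoint]
  obtain ⟨b, c, hc, hb1, hb2⟩ := linear_of_semilinear (F := F) (G := G)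
    (γ := fun w => g (0, w)) (q := fun w => f (0, w)) (a := a) hF hF0 hF1 hFn hG hG0 hGn hγ hg0 hγ1
    hq hf0
    (by
      have : Tendsto (fun u : ℝ => ((0 : ℝ), u)) (𝓝 0) (𝓝 0) :=
        (show Continuous (fun u : ℝ => ((0 : ℝ), u)) by fun_prop).tendsto 0
      filter_upwards [this.eventually hre] with u hu
      simpa [tubePoint, hF0] using hu) hfre0
    (by
      filter_upwards [hre_eq, s2.eventually hR, s2.eventually (tp.eventually hg_eq)]
        with t h1 h2 h3
      rw [← h1, ← h2, h3]
      rfl)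
    (by
      filter_upwards [hre_eq, s2.eventually hoff] with t h1 h2 ht
      rw [← h1]
      exact h2 ht)
  refine ⟨a, b, c, hfre0, hc, ?_⟩
  filter_upwards [hf_eq, hg_eq, (continuous_snd.tendsto (0 : ℂ × ℂ)).eventually hb1,
    (continuous_snd.tendsto (0 : ℂ × ℂ)).eventually hb2] with p h1 h2 h3 h4
  exact ⟨by rw [h1, h4], by rw [h2, h3]⟩

end TubeMap

/-- If `Im φ` is `O(tⁿ)` along every ray, then `φ` vanishes to order `n`. -/
lemma exists_eq_pow_mul_of_im {φ : ℂ → ℂ} (hφ : AnalyticAt ℂ φ 0) (h0 : φ 0 = 0) (n : ℕ)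
    (h : ∀ ω : ℂ, ‖ω‖ = 1 →
      ∃ L : ℝ, Tendsto (fun t : ℝ => (φ (t * ω)).im / t ^ n) (𝓝[>] 0) (𝓝 L)) :
    ∃ ψ : ℂ → ℂ, AnalyticAt ℂ ψ 0 ∧ ∀ᶠ z in 𝓝 0, φ z = z ^ n * ψ z := by
  by_cases hfl : φ =ᶠ[𝓝 0] 0
  · refine ⟨0, analyticAt_const, hfl.mono fun z hz => ?_⟩
    simpa using hz
  obtain ⟨m, ψ, h1, h2, h3⟩ := hφ.exists_eventuallyEq_pow_smul_nonzero_iff.2 hfl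
  simp only [sub_zero, smul_eq_mul] at h3
  rcases le_or_gt n m with hnm | hnm
  · refine ⟨fun z => z ^ (m - n) * ψ z, (analyticAt_id.pow _).mul h1, h3.mono fun z hz => ?_⟩
    simp only [hz]
    rw [← mul_assoc, ← pow_add, Nat.add_sub_cancel' hnm]
  exfalso
  have hm : m ≠ 0 := by
    rintro rfl
    have := h3.self_of_nhds
    simp [h0] at this
    exact h2 this.symm
  have hn0 : (‖ψ 0‖ : ℂ) ≠ 0 := by simpa using h2
  obtain ⟨ω, hω⟩ := IsAlgClosed.exists_pow_nat_eq
    (Complex.I * starRingEnd ℂ (ψ 0) / ‖ψ 0‖) (Nat.pos_of_ne_zero hm)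
  have hω1 : ‖ω‖ = 1 := by
    have : ‖ω‖ ^ m = 1 := by
      rw [← norm_pow, hω]
      simp [h2]
    exact (pow_eq_one_iff_of_nonneg (norm_nonneg _) hm).1 this
  have hωψ : (ω ^ m * ψ 0).im = ‖ψ 0‖ := by
    have : ω ^ m * ψ 0 = Complex.I * ‖ψ 0‖ := by
      rw [hω]
      field_simp
      rw [mul_comm, Complex.mul_conj, Complex.normSq_eq_norm_sq]
      push_cast; ring
    rw [this]; simp
  obtain ⟨L, hL⟩ := h ω hω1
  have hray : Tendsto (fun t : ℝ => (t : ℂ) * ω) (𝓝[>] 0) (𝓝 0) := by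
    have := (show Continuous fun t : ℝ => (t : ℂ) * ω by fun_prop).tendsto 0
    simpa using this.mono_left nhdsWithin_le_nhds
  have l1 : Tendsto (fun t : ℝ => (φ (t * ω)).im / t ^ m) (𝓝[>] 0) (𝓝 ‖ψ 0‖) := by
    have := (Complex.continuous_im.tendsto _).comp
      ((h1.continuousAt.tendsto.comp hray).const_mul (ω ^ m))
    rw [hωψ] at this
    refine this.congr' ?_
    filter_upwards [hray.eventually h3, self_mem_nhdsWithin] with t ht ht0
    have ht0' : (t : ℝ) ^ m ≠ 0 := pow_ne_zero _ (ne_of_gt ht0)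
    rw [ht, mul_pow, mul_assoc, ← Complex.ofReal_pow, Complex.im_ofReal_mul,
      mul_div_cancel_left₀ _ ht0']
    rfl
  have l2 : Tendsto (fun t : ℝ => (φ (t * ω)).im / t ^ m) (𝓝[>] 0) (𝓝 0) := by
    have h4 : Tendsto (fun t : ℝ => t ^ (n - m)) (𝓝[>] 0) (𝓝 0) := by
      have := (continuous_pow (M := ℝ) (n - m)).tendsto 0
      rw [zero_pow (by omega)] at this
      exact this.mono_left nhdsWithin_le_nhds
    have h5 := hL.mul h4
    rw [mul_zero] at h5
    refine h5.congr' ?_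
    filter_upwards [self_mem_nhdsWithin] with t ht0
    have ht0' : t ≠ 0 := ne_of_gt ht0
    rw [show t ^ n = t ^ m * t ^ (n - m) by rw [← pow_add]; congr 1; omega]
    field_simp
  exact h2 (norm_eq_zero.1 (tendsto_nhds_unique l1 l2))

lemma infinite_unit_circle : {z : ℂ | ‖z‖ = 1}.Infinite := by
  have h : IsPreconnected (Metric.sphere (0 : ℂ) 1) :=
    isPreconnected_sphere (by rw [Complex.rank_real_complex]; exact Cardinal.one_lt_two) 0 1
  have e : {z : ℂ | ‖z‖ = 1} = Metric.sphere (0 : ℂ) 1 := by ext; simp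
  rw [e]
  refine h.infinite_of_nontrivial ⟨1, by simp, -1, by simp, ?_⟩
  norm_num

/-- On the unit circle the leading term contains no frequencies `±k`. -/
lemma leadingTerm_coeff_eq_zero {k : ℕ} {a : ℕ → ℂ} {μ s : ℂ} (hμ : μ ≠ 0)
    (h : ∀ ω : ℂ, ‖ω‖ = 1 → μ * leadingTerm k a ω = ((s * ω ^ k).im : ℂ)) :
    ∀ j ∈ Finset.Ico 1 k, a j = 0 := by
  set Q : Polynomial ℂ := ∑ j ∈ Finset.Ico 1 k, Polynomial.C (μ * a j) * Polynomial.X ^ j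
    - Polynomial.C (s / (2 * Complex.I)) * Polynomial.X ^ k
    + Polynomial.C (starRingEnd ℂ s / (2 * Complex.I)) with hQ
  have hroot : ∀ ζ : ℂ, ‖ζ‖ = 1 → Q.IsRoot ζ := by
    intro ζ hζ
    obtain ⟨ω, hω⟩ := IsAlgClosed.exists_pow_nat_eq ζ (n := 2) two_pos
    have hω1 : ‖ω‖ = 1 := by
      have : ‖ω‖ ^ 2 = 1 := by rw [← norm_pow, hω, hζ]
      exact (pow_eq_one_iff_of_nonneg (norm_nonneg _) two_ne_zero).1 this
    have hc : starRingEnd ℂ ω * ω = 1 := by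
      rw [mul_comm, Complex.mul_conj, Complex.normSq_eq_norm_sq, hω1]; simp
    have h1 := congrArg (fun x => x * ω ^ k) (h ω hω1)
    have h2 : leadingTerm k a ω * ω ^ k = ∑ j ∈ Finset.Ico 1 k, a j * ζ ^ j := by
      rw [leadingTerm, Finset.sum_mul]
      refine Finset.sum_congr rfl fun j hj => ?_
      have hjk : k = (k - j) + j := by have := Finset.mem_Ico.1 hj; omega
      have : (starRingEnd ℂ ω) ^ (k - j) * ω ^ k = ω ^ j := by
        conv_lhs => rw [hjk]
        rw [Nat.add_sub_cancel, pow_add, ← mul_assoc, ← mul_pow, hc, one_pow, one_mul]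
      rw [mul_assoc, this, ← hω]
      ring
    have h3 : ((s * ω ^ k).im : ℂ) * ω ^ k
        = s / (2 * Complex.I) * ζ ^ k - starRingEnd ℂ s / (2 * Complex.I) := by
      have : (starRingEnd ℂ ω) ^ k * ω ^ k = 1 := by rw [← mul_pow, hc, one_pow]
      rw [Complex.im_eq_sub_conj, map_mul, map_pow, ← hω]
      linear_combination -(starRingEnd ℂ s / (2 * Complex.I)) * this
    simp only [mul_assoc, h2, h3, Finset.mul_sum] at h1
    rw [Polynomial.IsRoot, hQ]
    simp only [Polynomial.eval_add, Polynomial.eval_sub, Polynomial.eval_finsetSum,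
      Polynomial.eval_mul, Polynomial.eval_C, Polynomial.eval_pow, Polynomial.eval_X, mul_assoc]
    rw [h1]
    ring
  have hQ0 : Q = 0 := Polynomial.eq_zero_of_infinite_isRoot Q
    (infinite_unit_circle.mono fun ζ hζ => hroot ζ hζ)
  intro j hj
  have hj' := Finset.mem_Ico.1 hj
  have := congrArg (fun q => q.coeff j) hQ0
  have hjk : j ≠ k := by omega
  have hj0 : j ≠ 0 := by omega
  simp only [hQ, Polynomial.coeff_add, Polynomial.coeff_sub, Polynomial.finsetSum_coeff,
    Polynomial.coeff_C_mul, Polynomial.coeff_X_pow, Polynomial.coeff_C, hjk, hj0, if_false,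
    Polynomial.coeff_zero, mul_ite, mul_one, mul_zero, Finset.sum_ite_eq, hj, if_true, sub_zero,
    add_zero] at this
  exact (mul_eq_zero.1 this).resolve_left hμ

lemma leadingTerm_real_mul (k : ℕ) (a : ℕ → ℂ) (t : ℝ) (ω : ℂ) :
    leadingTerm k a (t * ω) = (t : ℂ) ^ k * leadingTerm k a ω := by
  rw [leadingTerm, leadingTerm, Finset.mul_sum]
  refine Finset.sum_congr rfl fun j hj => ?_
  have hjk : k = j + (k - j) := by have := Finset.mem_Ico.1 hj; omega
  rw [map_mul, Complex.conj_ofReal, mul_pow, mul_pow]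
  have : (t : ℂ) ^ k = t ^ j * t ^ (k - j) := by rw [← pow_add, ← hjk]
  rw [this]
  ring

lemma leadingTerm_zero (k : ℕ) (a : ℕ → ℂ) : leadingTerm k a 0 = 0 :=
  Finset.sum_eq_zero fun j hj => by
    have := Finset.mem_Ico.1 hj
    rw [zero_pow (by omega)]; ring

section Normal

variable {k : ℕ} {H : ℂ × ℝ → ℝ} {a : ℕ → ℂ} {F : ℝ → ℝ} {f g : ℂ × ℂ → ℂ}

lemma normal_form_zero (hk : k ≠ 0)
    (ho : (fun q : ℂ × ℝ => (H q : ℂ) - leadingTerm k a q.1) =o[𝓝 0]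
      (fun q : ℂ × ℝ => ‖q.1‖ ^ k + |q.2|)) : H 0 = 0 := by
  have h1 := (ho.def one_pos).self_of_nhds
  simpa [leadingTerm_zero, hk] using h1

lemma tendsto_normal_form_ray
    (ho : (fun q : ℂ × ℝ => (H q : ℂ) - leadingTerm k a q.1) =o[𝓝 0]
      (fun q : ℂ × ℝ => ‖q.1‖ ^ k + |q.2|)) {ω : ℂ} (hω : ‖ω‖ = 1) :
    Tendsto (fun t : ℝ => (H (t * ω, 0) : ℂ) / t ^ k) (𝓝[>] 0) (𝓝 (leadingTerm k a ω)) := by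
  have hray : Tendsto (fun t : ℝ => ((t : ℂ) * ω, (0 : ℝ))) (𝓝[>] 0) (𝓝 0) := by
    have := (show Continuous fun t : ℝ => ((t : ℂ) * ω, (0 : ℝ)) by fun_prop).tendsto 0
    rw [show (((0 : ℝ) : ℂ) * ω, (0 : ℝ)) = 0 by simp] at this
    exact this.mono_left nhdsWithin_le_nhds
  have h1 := ho.comp_tendsto hray
  have h2 : (fun t : ℝ => (H (t * ω, 0) : ℂ) - t ^ k * leadingTerm k a ω) =o[𝓝[>] 0]
      (fun t : ℝ => (t : ℂ) ^ k) := by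
    refine (h1.congr_left fun t => by simp [leadingTerm_real_mul]).trans_isBigO ?_
    refine IsBigO.of_bound 1 (Eventually.of_forall fun t => ?_)
    simp [hω]
  have h3 := h2.tendsto_div_nhds_zero.add_const (leadingTerm k a ω)
  rw [zero_add] at h3
  refine h3.congr' ?_
  filter_upwards [self_mem_nhdsWithin] with t ht
  have : (t : ℂ) ≠ 0 := by simpa using (ne_of_gt (show 0 < t from ht))
  field_simp
  ring

lemma tendsto_normal_form_ray_lt {n : ℕ} (hn : n < k)
    (ho : (fun q : ℂ × ℝ => (H q : ℂ) - leadingTerm k a q.1) =o[𝓝 0]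
      (fun q : ℂ × ℝ => ‖q.1‖ ^ k + |q.2|)) {ω : ℂ} (hω : ‖ω‖ = 1) :
    Tendsto (fun t : ℝ => (H (t * ω, 0) : ℂ) / t ^ n) (𝓝[>] 0) (𝓝 0) := by
  have h4 : Tendsto (fun t : ℝ => (t : ℂ) ^ (k - n)) (𝓝[>] 0) (𝓝 0) := by
    have := (show Continuous fun t : ℝ => (t : ℂ) ^ (k - n) by fun_prop).tendsto 0
    rw [Complex.ofReal_zero, zero_pow (by omega)] at this
    exact this.mono_left nhdsWithin_le_nhds
  have h5 := (tendsto_normal_form_ray ho hω).mul h4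
  rw [mul_zero] at h5
  refine h5.congr' ?_
  filter_upwards [self_mem_nhdsWithin] with t ht
  have : (t : ℂ) ≠ 0 := by simpa using (ne_of_gt (show 0 < t from ht))
  rw [show (t : ℂ) ^ k = t ^ n * t ^ (k - n) by rw [← pow_add]; congr 1; omega]
  field_simp

/-- Along a ray, replacing the second coordinate `i H(z, 0)` by `0` changes an analytic function
by `i H(z, 0)` times its second partial derivative, up to higher order terms. -/
lemma tendsto_ray_difference (hg : AnalyticAt ℂ g 0) {n : ℕ} {ω L : ℂ} {η : ℝ → ℝ}
    (hη : Tendsto η (𝓝[>] 0) (𝓝 0))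
    (h : Tendsto (fun t : ℝ => (η t : ℂ) / t ^ n) (𝓝[>] 0) (𝓝 L)) :
    Tendsto (fun t : ℝ => (g (t * ω, η t * Complex.I) - g (t * ω, 0)) / t ^ n) (𝓝[>] 0)
      (𝓝 (L * Complex.I * dw g 0)) := by
  have hs := hg.hasStrictFDerivAt.isLittleO
  have hray : Tendsto (fun t : ℝ => (t : ℂ) * ω) (𝓝[>] 0) (𝓝 0) := by
    have := (show Continuous fun t : ℝ => (t : ℂ) * ω by fun_prop).tendsto 0
    simpa using this.mono_left nhdsWithin_le_nhds
  have hη' : Tendsto (fun t => (η t : ℂ) * Complex.I) (𝓝[>] 0) (𝓝 0) := by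
    have := ((Complex.continuous_ofReal.tendsto 0).comp hη).mul_const Complex.I
    simpa [Function.comp_def] using this
  have hp : Tendsto (fun t : ℝ => (((t : ℂ) * ω, (η t : ℂ) * Complex.I), ((t : ℂ) * ω, (0 : ℂ))))
      (𝓝[>] 0) (𝓝 ((0 : ℂ × ℂ), (0 : ℂ × ℂ))) :=
    (hray.prodMk_nhds hη').prodMk_nhds (hray.prodMk_nhds tendsto_const_nhds)
  have h1 := hs.comp_tendsto hp
  have hne : ∀ᶠ t : ℝ in 𝓝[>] 0, (t : ℂ) ^ n ≠ 0 := by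
    filter_upwards [self_mem_nhdsWithin] with t ht
    exact pow_ne_zero _ (by simpa using (ne_of_gt (show 0 < t from ht)))
  have h2 : (fun t : ℝ => (η t : ℂ)) =O[𝓝[>] 0] (fun t : ℝ => (t : ℂ) ^ n) :=
    isBigO_of_div_tendsto_nhds (hne.mono fun t ht h0 => absurd h0 ht) L h
  have h3 : (fun t : ℝ => g (t * ω, η t * Complex.I) - g (t * ω, 0)
      - η t * Complex.I * dw g 0) =o[𝓝[>] 0] (fun t : ℝ => (t : ℂ) ^ n) := by
    refine ((h1.congr_left fun t => ?_).trans_isBigO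
      (IsBigO.of_bound 1 (Eventually.of_forall fun t => ?_))).trans_isBigO h2
    · simp [fderiv_apply_eq_dz_dw]
    · simp
  have h4 := h3.tendsto_div_nhds_zero.add ((h.mul_const Complex.I).mul_const (dw g 0))
  rw [zero_add] at h4
  refine h4.congr' ?_
  filter_upwards [hne] with t ht
  field_simp
  ring

lemma hasDerivAt_normal_form_u (hk : k ≠ 0)
    (ho : (fun q : ℂ × ℝ => (H q : ℂ) - leadingTerm k a q.1) =o[𝓝 0]
      (fun q : ℂ × ℝ => ‖q.1‖ ^ k + |q.2|)) : HasDerivAt (fun t : ℝ => H (0, t)) 0 0 := by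
  have line : Tendsto (fun t : ℝ => ((0 : ℂ), t)) (𝓝 0) (𝓝 0) :=
    (show Continuous fun t : ℝ => ((0 : ℂ), t) by fun_prop).tendsto 0
  have h1 := ho.comp_tendsto line
  have h2 : (fun t : ℝ => H (0, t)) =o[𝓝 0] (fun t : ℝ => t) := by
    refine IsLittleO.of_norm_norm (h1.norm_norm.congr (fun t => ?_) fun t => ?_)
    · simp [leadingTerm_zero]
    · simp [hk]
  rw [hasDerivAt_iff_isLittleO_nhds_zero]
  simpa [show H (0, 0) = 0 from normal_form_zero hk ho] using h2

lemma exists_eq_sq_mul (hF : AnalyticAt ℝ F 0) (hF0 : F 0 = 0) (hF1 : deriv F 0 = 0) :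
    ∃ F₂ : ℝ → ℝ, ContinuousAt F₂ 0 ∧ (∀ s, F s = s ^ 2 * F₂ s) ∧
      deriv (deriv F) 0 = 2 * F₂ 0 := by
  have hds : ∀ {φ : ℝ → ℝ}, AnalyticAt ℝ φ 0 → AnalyticAt ℝ (dslope φ 0) 0 := by
    intro φ ⟨p, hp⟩
    exact ⟨_, hp.has_fpower_series_dslope_fslope⟩
  have hmul : ∀ {φ : ℝ → ℝ}, φ 0 = 0 → ∀ s, φ s = s * dslope φ 0 s := by
    intro φ h s
    have := sub_smul_dslope φ 0 s
    simpa [h] using this.symm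
  have h1 : dslope F 0 0 = 0 := by rw [dslope_same, hF1]
  have hF₂ := hds (hds hF)
  have heq : ∀ s, F s = s ^ 2 * dslope (dslope F 0) 0 s := fun s => by
    rw [hmul hF0 s, hmul h1 s]; ring
  refine ⟨dslope (dslope F 0) 0, hF₂.continuousAt, heq, ?_⟩
  set F₂ := dslope (dslope F 0) 0
  have hd : deriv F =ᶠ[𝓝 0] fun s => 2 * s * F₂ s + s ^ 2 * deriv F₂ s := by
    filter_upwards [hF₂.eventually_analyticAt] with s hs
    have h2 := ((hasDerivAt_id s).pow 2).mul hs.differentiableAt.hasDerivAt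
    rw [show F = fun s => s ^ 2 * F₂ s from funext heq]
    refine h2.deriv.trans ?_
    simp
  rw [hd.deriv_eq]
  have h3 := (((hasDerivAt_id (0 : ℝ)).const_mul 2).mul hF₂.differentiableAt.hasDerivAt).add
    (((hasDerivAt_id (0 : ℝ)).pow 2).mul hF₂.deriv.differentiableAt.hasDerivAt)
  refine h3.deriv.trans ?_
  simp

lemma not_flat_and_deriv_deriv_eq_zero (hk : 2 < k) (hF : AnalyticAt ℝ F 0) (hF0 : F 0 = 0)
    (hF1 : deriv F 0 = 0) (hf : AnalyticAt ℂ f 0) (hf0 : f 0 = 0)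
    (hg : AnalyticAt ℂ g 0) (hg0 : g 0 = 0)
    (hJ : dz f 0 * dw g 0 - dw f 0 * dz g 0 ≠ 0) (hH : ContinuousAt H 0)
    (ha : ∃ j ∈ Finset.Ico 1 k, a j ≠ 0)
    (ho : (fun q : ℂ × ℝ => (H q : ℂ) - leadingTerm k a q.1) =o[𝓝 0]
      (fun q : ℂ × ℝ => ‖q.1‖ ^ k + |q.2|))
    (hM : ∀ᶠ q : ℂ × ℝ in 𝓝 0,
      (g (q.1, q.2 + H q * Complex.I)).im = F (f (q.1, q.2 + H q * Complex.I)).re) :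
    deriv (deriv F) 0 = 0 ∧ ¬ F =ᶠ[𝓝 0] 0 := by
  have hk0 : k ≠ 0 := by omega
  have hH0 : H (0, 0) = 0 := normal_form_zero hk0 ho
  obtain ⟨F₂, hF₂, hFF₂, hF''⟩ := exists_eq_sq_mul hF hF0 hF1
  have hray : ∀ ω : ℂ, Tendsto (fun t : ℝ => ((t : ℂ) * ω, (0 : ℝ))) (𝓝[>] 0) (𝓝 0) := by
    intro ω
    have := (show Continuous fun t : ℝ => ((t : ℂ) * ω, (0 : ℝ)) by fun_prop).tendsto 0
    rw [show (((0 : ℝ) : ℂ) * ω, (0 : ℝ)) = 0 by simp] at this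
    exact this.mono_left nhdsWithin_le_nhds
  have hη : ∀ ω : ℂ, Tendsto (fun t : ℝ => H (t * ω, 0)) (𝓝[>] 0) (𝓝 0) := by
    intro ω
    have := hH.tendsto.comp (hray ω)
    rwa [show H 0 = 0 from hH0] at this
  have hMr : ∀ ω : ℂ, ∀ᶠ t : ℝ in 𝓝[>] 0, (g (t * ω, H (t * ω, 0) * Complex.I)).im
      = F (f (t * ω, H (t * ω, 0) * Complex.I)).re := by
    intro ω
    filter_upwards [(hray ω).eventually hM] with t ht
    simpa using ht
  have dray : ∀ {h : ℂ × ℂ → ℂ}, AnalyticAt ℂ h 0 → h 0 = 0 → ∀ ω : ℂ,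
      Tendsto (fun t : ℝ => h (t * ω, 0) / t) (𝓝[>] 0) (𝓝 (ω * dz h 0)) := by
    intro h hh h0 ω
    have hz : HasDerivAt (fun t : ℝ => (t : ℂ) * ω) ω 0 := by
      simpa using (Complex.ofRealCLM.hasDerivAt (x := 0)).mul_const ω
    have h1 := hasDerivAt_comp_curve (h := h) (z := fun t : ℝ => (t : ℂ) * ω)
      (w := fun _ => 0) (by rw [Complex.ofReal_zero, zero_mul]; exact hh) hz
      (hasDerivAt_const (0 : ℝ) (0 : ℂ))
    have h2 := (hasDerivAt_iff_tendsto_slope.1 h1).mono_left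
      (nhdsWithin_mono (0 : ℝ) fun t (ht : 0 < t) => ne_of_gt ht)
    have h00 : h (0, 0) = 0 := h0
    simp only [Complex.ofReal_zero, zero_mul, add_zero] at h2
    refine h2.congr fun t => ?_
    simp [slope, h00]
    field_simp
  have hFlim : ∀ ω : ℂ, ‖ω‖ = 1 →
      Tendsto (fun t : ℝ => F (f (t * ω, H (t * ω, 0) * Complex.I)).re / t ^ 2) (𝓝[>] 0)
        (𝓝 ((ω * dz f 0).re ^ 2 * F₂ 0)) := by
    intro ω hω
    have h1 := tendsto_ray_difference hf (n := 1) (ω := ω) (hη ω)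
      (tendsto_normal_form_ray_lt (n := 1) (by omega) ho hω)
    have h2 := (dray hf hf0 ω).add h1
    have h3 : Tendsto (fun t : ℝ => (f (t * ω, H (t * ω, 0) * Complex.I)).re / t) (𝓝[>] 0)
        (𝓝 (ω * dz f 0).re) := by
      have := (Complex.continuous_re.tendsto _).comp h2
      rw [zero_mul, zero_mul, add_zero] at this
      refine this.congr fun t => ?_
      simp only [Function.comp_apply, pow_one, ← add_div, add_sub_cancel, Complex.div_ofReal_re]
    have h4 : Tendsto (fun t : ℝ => (f (t * ω, H (t * ω, 0) * Complex.I)).re) (𝓝[>] 0)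
        (𝓝 0) := by
      have h5 : Tendsto (fun t : ℝ => t) (𝓝[>] 0) (𝓝 0) := nhdsWithin_le_nhds
      have := h3.mul h5
      rw [mul_zero] at this
      refine this.congr' ?_
      filter_upwards [self_mem_nhdsWithin] with t ht
      exact div_mul_cancel₀ _ (ne_of_gt (show 0 < t from ht))
    refine ((h3.pow 2).mul (hF₂.tendsto.comp h4)).congr fun t => ?_
    rw [hFF₂, div_pow, Function.comp_apply]
    ring
  have hglim : ∀ (n : ℕ) (ω L : ℂ) (ℓ : ℝ), ‖ω‖ = 1 →
      Tendsto (fun t : ℝ => (H (t * ω, 0) : ℂ) / t ^ n) (𝓝[>] 0) (𝓝 L) →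
      Tendsto (fun t : ℝ => F (f (t * ω, H (t * ω, 0) * Complex.I)).re / t ^ n) (𝓝[>] 0) (𝓝 ℓ) →
      Tendsto (fun t : ℝ => (g (t * ω, 0)).im / t ^ n) (𝓝[>] 0)
        (𝓝 (ℓ - (L * Complex.I * dw g 0).im)) := by
    intro n ω L ℓ hω hL hℓ
    have h1 := (Complex.continuous_im.tendsto _).comp
      (tendsto_ray_difference hg (n := n) (ω := ω) (hη ω) hL)
    refine (hℓ.sub h1).congr' ?_
    filter_upwards [hMr ω] with t ht
    rw [← ht, Function.comp_apply, ← Complex.ofReal_pow, Complex.div_ofReal_im, Complex.sub_im]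
    ring
  have hφ : AnalyticAt ℂ (fun z => g (z, 0)) 0 :=
    AnalyticAt.comp₂ (h := g) hg analyticAt_id analyticAt_const
  have hlim2 : ∀ ω : ℂ, ‖ω‖ = 1 → Tendsto (fun t : ℝ => (g (t * ω, 0)).im / t ^ 2) (𝓝[>] 0)
      (𝓝 ((ω * dz f 0).re ^ 2 * F₂ 0)) := by
    intro ω hω
    have := hglim 2 ω 0 _ hω (tendsto_normal_form_ray_lt hk ho hω) (hFlim ω hω)
    simpa using this
  have hpow : ∀ (n : ℕ) (ψ : ℂ → ℂ), AnalyticAt ℂ ψ 0 →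
      (∀ᶠ z in 𝓝 (0 : ℂ), g (z, 0) = z ^ n * ψ z) → ∀ ω : ℂ,
      Tendsto (fun t : ℝ => g (t * ω, 0) / t ^ n) (𝓝[>] 0) (𝓝 (ω ^ n * ψ 0)) := by
    intro n ψ hψ he ω
    have hr : Tendsto (fun t : ℝ => (t : ℂ) * ω) (𝓝[>] 0) (𝓝 0) :=
      (continuous_fst.tendsto (0 : ℂ × ℝ)).comp (hray ω)
    refine ((hψ.continuousAt.tendsto.comp hr).const_mul (ω ^ n)).congr' ?_
    filter_upwards [hr.eventually he, self_mem_nhdsWithin] with t ht ht0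
    have : (t : ℂ) ≠ 0 := by simpa using (ne_of_gt (show 0 < t from ht0))
    rw [ht, mul_pow, Function.comp_apply]
    field_simp
  have hpow_im : ∀ (n : ℕ) (ψ : ℂ → ℂ), AnalyticAt ℂ ψ 0 →
      (∀ᶠ z in 𝓝 (0 : ℂ), g (z, 0) = z ^ n * ψ z) → ∀ ω : ℂ,
      Tendsto (fun t : ℝ => (g (t * ω, 0)).im / t ^ n) (𝓝[>] 0) (𝓝 (ω ^ n * ψ 0).im) := by
    intro n ψ hψ he ω
    refine ((Complex.continuous_im.tendsto _).comp (hpow n ψ hψ he ω)).congr fun t => ?_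
    rw [Function.comp_apply, ← Complex.ofReal_pow, Complex.div_ofReal_im]
  obtain ⟨ψ, hψ, hψe⟩ := exists_eq_pow_mul_of_im hφ hg0 2 fun ω hω => ⟨_, hlim2 ω hω⟩
  have hgz : dz g 0 = 0 := by
    have h1 := hpow 1 (fun z => z * ψ z) (analyticAt_id.mul hψ)
      (hψe.mono fun z hz => by rw [hz]; ring) 1
    have h2 := dray hg hg0 1
    simp only [pow_one] at h1
    simpa using tendsto_nhds_unique h2 h1
  have hfz : dz f 0 ≠ 0 := fun h => hJ (by rw [h, hgz]; ring)
  have hgw : dw g 0 ≠ 0 := fun h => hJ (by rw [h, hgz]; ring)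
  have hF₂0 : F₂ 0 = 0 := by
    have h1 := tendsto_nhds_unique (hpow_im 2 ψ hψ hψe 1) (hlim2 1 (by simp))
    have h2 := tendsto_nhds_unique (hpow_im 2 ψ hψ hψe Complex.I) (hlim2 Complex.I (by simp))
    simp only [one_pow, one_mul, Complex.I_sq, neg_mul, Complex.neg_im, Complex.mul_re,
      Complex.I_re, Complex.I_im, zero_mul, zero_sub] at h1 h2
    have h3 : Complex.normSq (dz f 0) * F₂ 0 = 0 := by
      rw [Complex.normSq_apply]
      linarith
    exact (mul_eq_zero.1 h3).resolve_left (by simpa using hfz)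
  refine ⟨by rw [hF'', hF₂0, mul_zero], fun hflat => ?_⟩
  obtain ⟨j, hj, haj⟩ := ha
  have hFk : ∀ ω : ℂ, Tendsto (fun t : ℝ => F (f (t * ω, H (t * ω, 0) * Complex.I)).re / t ^ k)
      (𝓝[>] 0) (𝓝 0) := by
    intro ω
    have hr : Tendsto (fun t : ℝ => (t : ℂ) * ω) (𝓝[>] 0) (𝓝 0) :=
      (continuous_fst.tendsto (0 : ℂ × ℝ)).comp (hray ω)
    have hη' : Tendsto (fun t : ℝ => (H (t * ω, 0) : ℂ) * Complex.I) (𝓝[>] 0) (𝓝 0) := by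
      have := ((Complex.continuous_ofReal.tendsto 0).comp (hη ω)).mul_const Complex.I
      simpa [Function.comp_def] using this
    have h1 := (Complex.continuous_re.tendsto (f 0)).comp
      (hf.continuousAt.tendsto.comp (hr.prodMk_nhds hη'))
    rw [hf0, Complex.zero_re] at h1
    refine tendsto_const_nhds.congr' ?_
    filter_upwards [h1.eventually hflat] with t ht
    simp only [Function.comp_apply, Pi.zero_apply] at ht
    rw [ht, zero_div]
  have hPre : ∀ ω : ℂ, ‖ω‖ = 1 → leadingTerm k a ω = ((leadingTerm k a ω).re : ℂ) := by
    intro ω hω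
    have h1 := tendsto_normal_form_ray ho hω
    have h2 := (Complex.continuous_im.tendsto _).comp h1
    refine Complex.ext rfl ?_
    refine tendsto_nhds_unique h2 (tendsto_const_nhds.congr fun t => ?_)
    rw [Function.comp_apply, ← Complex.ofReal_pow, Complex.div_ofReal_im]
    simp
  have hlimk : ∀ ω : ℂ, ‖ω‖ = 1 → Tendsto (fun t : ℝ => (g (t * ω, 0)).im / t ^ k) (𝓝[>] 0)
      (𝓝 (-((leadingTerm k a ω).re * (dw g 0).re))) := by
    intro ω hω
    have := hglim k ω _ _ hω (tendsto_normal_form_ray ho hω) (hFk ω)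
    rw [hPre ω hω] at this
    simpa using this
  have hgwim : (dw g 0).im = 0 := by
    have hu := hasDerivAt_normal_form_u hk0 ho
    have hw : HasDerivAt (fun t : ℝ => (t : ℂ) + H (0, t) * Complex.I) 1 0 := by
      have := (Complex.ofRealCLM.hasDerivAt (x := 0)).add ((hu.ofReal_comp).mul_const Complex.I)
      simp only [Complex.ofRealCLM_apply, Complex.ofReal_one, Complex.ofReal_zero, zero_mul,
        add_zero] at this
      exact this
    have e0 : ((0 : ℂ), ((0 : ℝ) : ℂ) + H (0, 0) * Complex.I) = 0 := by simp [hH0]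
    have hc : ∀ {h : ℂ × ℂ → ℂ}, AnalyticAt ℂ h 0 →
        HasDerivAt (fun t : ℝ => h (0, (t : ℂ) + H (0, t) * Complex.I)) (dw h 0) 0 := by
      intro h hh
      have := hasDerivAt_comp_curve (h := h) (z := fun _ => 0) (by rwa [e0])
        (hasDerivAt_const (0 : ℝ) (0 : ℂ)) hw
      rw [e0] at this
      simpa using this
    have hFd : HasDerivAt F 0 ((f (0, ((0 : ℝ) : ℂ) + H (0, 0) * Complex.I)).re) := by
      rw [e0, hf0, Complex.zero_re]
      simpa only [hF1] using hF.differentiableAt.hasDerivAt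
    have line : Tendsto (fun t : ℝ => ((0 : ℂ), t)) (𝓝 0) (𝓝 0) :=
      (show Continuous fun t : ℝ => ((0 : ℂ), t) by fun_prop).tendsto 0
    have := deriv_eq_of_eventually_eq (hasDerivAt_im (hc hg))
      (hFd.comp (0 : ℝ) (hasDerivAt_re (hc hf))) (line.eventually hM)
    simpa using this
  have hμ : (dw g 0).re ≠ 0 := fun h => hgw (Complex.ext h hgwim)
  obtain ⟨χ, hχ, hχe⟩ := exists_eq_pow_mul_of_im hφ hg0 k fun ω hω => ⟨_, hlimk ω hω⟩
  refine haj (leadingTerm_coeff_eq_zero (μ := -((dw g 0).re : ℂ)) (s := χ 0)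
    (by simpa using hμ) (fun ω hω => ?_) j hj)
  have := tendsto_nhds_unique (hpow_im k χ hχ hχe ω) (hlimk ω hω)
  rw [mul_comm (χ 0), this, hPre ω hω]
  push_cast
  simp
  ring

end Normal

/-- A tube tangent to `{v = 0}` of finite type `k > 2` is Levi degenerate at the origin but not
Levi flat. -/
theorem HasFiniteTypeAt.deriv_deriv_eq_zero_and_not_flat {k : ℕ} (hk : 2 < k)
    {F : ℝ → ℝ} (hF : AnalyticAt ℝ F 0) (hF0 : F 0 = 0) (hF1 : deriv F 0 = 0) (h : HasFiniteTypeAt (tube F) 0 k) :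
    deriv (deriv F) 0 = 0 ∧ ¬ F =ᶠ[𝓝 0] 0 := by
  obtain ⟨Φ, H, a, hΦ, hΦ0, hH, hM, -, ha, ho⟩ := h
  obtain ⟨Θ, hΘ, hΘ0, hΘΦ, hΦΘ⟩ := hΦ.exists_inverse
  have hJ := _root_.jacobian_ne_zero (Φ := Θ) (Θ := Φ) (p := Φ 0) hΘ
    (by rw [hΘ0]; exact hΦ.analyticAt) hΦΘ
  rw [hΦ0] at hΘ hΘ0 hΦΘ hJ
  refine not_flat_and_deriv_deriv_eq_zero (f := fun q => (Θ q).1) (g := fun q => (Θ q).2) hk hF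
    hF0 hF1 (analyticAt_fst.comp hΘ) (by simp [hΘ0]) (analyticAt_snd.comp hΘ) (by simp [hΘ0])
    hJ hH.continuousAt ha ho ?_
  have hH0 : H 0 = 0 := normal_form_zero (by omega) ho
  have ht : Tendsto (fun q : ℂ × ℝ => (q.1, (q.2 : ℂ) + H q * Complex.I)) (𝓝 0) (𝓝 0) := by
    have hc := hH.continuousAt
    have : ContinuousAt (fun q : ℂ × ℝ => (q.1, (q.2 : ℂ) + H q * Complex.I)) 0 := by fun_prop
    rw [ContinuousAt] at this
    convert this using 2
    simp [hH0, Prod.ext_iff]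
  have hΘt : Tendsto Θ (𝓝 0) (𝓝 0) := by simpa [ContinuousAt, hΘ0] using hΘ.continuousAt
  filter_upwards [ht.eventually hΦΘ, (hΘt.comp ht).eventually hM] with q h1 h2
  simp only [Function.comp_apply] at h2
  rw [h1] at h2
  exact h2.2 (by simp)

/-- `F` and `G` are real analytic near `0`, and `{v = 0}` is tangent to both tubes at the origin
(`F(0) = F'(0) = 0`, `G(0) = G'(0) = 0`). Everything is in the sense of germs at the origin. -/
theorem proposition5p1 (k : ℕ) (hk : 2 < k) (F G : ℝ → ℝ)
    (hF : AnalyticAt ℝ F 0) (hF0 : F 0 = 0) (hF1 : deriv F 0 = 0)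
    (hG : AnalyticAt ℝ G 0) (hG0 : G 0 = 0) (hG1 : deriv G 0 = 0)
    (hFk : HasFiniteTypeAt (tube F) 0 k) (hGk : HasFiniteTypeAt (tube G) 0 k)
    (Ψ : ℂ × ℂ → ℂ × ℂ) (hΨ : IsLocalBiholomorphismAt Ψ 0) (hΨ0 : Ψ 0 = 0)
    (hmap : ∀ᶠ p in 𝓝 (0 : ℂ × ℂ), p ∈ tube F → Ψ p ∈ tube G) :
    ∃ a b c : ℝ, a ≠ 0 ∧ c ≠ 0 ∧
      (∀ᶠ p in 𝓝 (0 : ℂ × ℂ),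
        Ψ p = ((a : ℂ) * p.1 + Complex.I * (b : ℂ) * p.2, (c : ℂ) * p.2)) ∧
      (∀ᶠ x in 𝓝 (0 : ℝ), G (a * x - b * F x) = c * F x) := by
  obtain ⟨hF2, hFn⟩ := hFk.deriv_deriv_eq_zero_and_not_flat hk hF hF0 hF1
  obtain ⟨-, hGn⟩ := hGk.deriv_deriv_eq_zero_and_not_flat hk hG hG0 hG1
  have tp := tendsto_tubePoint hF hF0
  have hΨa := hΨ.analyticAt
  have hR : ∀ᶠ t in 𝓝 0, (Ψ (tubePoint F t)).2.im = G (Ψ (tubePoint F t)).1.re := by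
    filter_upwards [tp.eventually hmap] with t ht
    exact ht (by simp [tube, tubePoint])
  obtain ⟨a, b, c, ha, hc, hlin⟩ := linear_of_tube_map (f := fun p => (Ψ p).1)
    (g := fun p => (Ψ p).2) hF hF0 hF1 hF2 hFn hG hG0 hG1 hGn (analyticAt_fst.comp hΨa)
    (by simp [hΨ0]) (analyticAt_snd.comp hΨa) (by simp [hΨ0]) hΨ.jacobian_ne_zero hR
  refine ⟨a, b, c, ha, hc, hlin.mono fun p hp => Prod.ext hp.1 hp.2, ?_⟩
  have line : Tendsto (fun x : ℝ => (x, (0 : ℝ), (0 : ℝ))) (𝓝 0) (𝓝 0) :=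
    (show Continuous fun x : ℝ => (x, (0 : ℝ), (0 : ℝ)) by fun_prop).tendsto 0
  filter_upwards [line.eventually hR, line.eventually (tp.eventually hlin)] with x h1 h2
  rw [h2.1, h2.2] at h1
  simpa [tubePoint, sub_eq_add_neg] using h1.symm
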